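/- **Setting.** Let $M$ be a finite-dimensional smooth manifold, $\pi:TM\setminus 0\to M$ its tangent bundle without the null section, $\mathscr V TM=\ker d\pi$ the vertical tangent bundle over $TM\setminus 0$, $i_w:T_{\pi(w)}M\to\mathscr V_wTM$, $i_w(u)=\frac{d}{dt}|_{t=0}(w+tu)$, the vertical lift, $V^{\mathfrak v}(w)=i_w(V(\pi(w)))$ the vertical lift of a vector field $V$ on $M$, $C(w)=i_w(w)$ the canonical vector field and $\mathscr J=i_w\circ d\pi$ the almost-tangent structure. Let $F:TM\to[0,\infty)$ be a Finsler metric: $F$ is smooth on $TM\setminus0$, $F(u)=0$ iff $u=0$, $F(\lambda u)=\lambda F(u)$ for $\lambda>0$, and for each $w\in TM\setminus 0$ the fundamental tensor $g_w(u,v)=\frac12\frac{\partial^2}{\partial t\partial s}|_{(0,0)}F(w+su+tv)^2$ is positive definite. Denote by $g$ also the metric on $\mathscr VTM$ given by $g(i_wu,i_wv)=g_w(u,v)$. Let $S$ be the geodesic spray of $F$, i.e. the smooth vector field on $TM\setminus0$ with $d(\tfrac12F^2)=\omega_F(S,\cdot)$, where $\omega_F$ is the pull-back of the canonical symplectic form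 $\sum dq^i\wedge dp_i$ of $T^*M$ by $w\mapsto g_w(w,\cdot)$; a curve $\gamma$ in $M$ is a geodesic if $\dot\gamma$ is an integral curve of $S$ in $TM\setminus 0$. Let $\Gamma_S=-[S,\mathscr J]$ (i.e. $\Gamma_S(X)=-([S,\mathscr JX]-\mathscr J[S,X])$) be the canonical connection of $S$, with horizontal distribution $\ker(\Gamma_S-I)$ and vertical projector $\mathscr V=\frac12(I-\Gamma_S)$; $u^{\mathfrak h}\in T_w(TM)$ denotes the horizontal lift at $w$ of $u\in T_{\pi(w)}M$. Let $\nabla$ be a smooth linear connection on the vector bundle $\mathscr VTM\to TM\setminus0$ that is a lift of $\Gamma_S$, i.e. $\nabla_XC=\mathscr VX$ for all $X\in T(TM\setminus0)$. Let ${\rm T}(X,Y)=\nabla_X\mathscr J(Y)-\nabla_Y\mathscr J(X)-\mathscr J[X,Y]$ be its torsion and $\mathscr C(X,Y)={\rm T}(\mathscr J(X),Y)$. Consider the conditions - **(T1)** ${\rm T}(S,Y)=0$ for all vector fields $Y$ on $TM\setminus 0$; - **(M1)** $(\nabla_Xg)(Y,C)=0$ for all $X$ and all vertical $Y$; - **(M2)**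 $g(\mathscr C(X,Y),\mathscr J(S))=0$ for all $X,Y$. For a nowhere null smooth vector field $W$ on an open set $\mathcal O\subseteq M$ and smooth vector fields $U,V$ on $\mathcal O$, put $(D^W_UV)(x)=i_{W(x)}^{-1}\bigl(\nabla_{U(x)^{\mathfrak h}}V^{\mathfrak v}\bigr)$, where $U(x)^{\mathfrak h}$ is the horizontal lift of $U(x)$ at $W(x)$. **Proposition.** Let $W,U,V,T$ be smooth vector fields on an open set $\mathcal O\subseteq M$, with $W$ nowhere null. (i) If (M1) and (M2) hold, then on $\mathcal O$ the function $g_W(W,V)$ is differentiable and $$U\,g_W(W,V)=g_W(D^W_UW,V)+g_W(W,D^W_UV).$$ (ii) Suppose that (T1) holds. If the integral curve of $W$ through some point $x_0\in\mathcal O$ is a geodesic, then at $x_0$ the function $g_W(T,V)$ is differentiable and $$W\,g_W(T,V)=g_W(D^W_WT,V)+g_W(T,D^W_WV).$$ -/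

import Mathlib

open Bundle Set
open scoped Manifold ContDiff Topology

namespace FinslerConn

noncomputable section

/-! Throughout, `M` is a smooth manifold (without boundary) modelled on the real normed space `E`,
`TM` is its tangent bundle, itself a smooth manifold modelled on `E × E`, and a vector field on an
open subset of `TM` is given by a section of `T(TM)` whose values off that subset are irrelevant. -/

variable {E : Type*} [NormedAddCommGroup E] [NormedSpace ℝ E]
  {M : Type*} [TopologicalSpace M] [ChartedSpace E M]

/-- The tangent bundle without the null section, as an open subset of `TM`. -/
def slit (E : Type*) [NormedAddCommGroup E] [NormedSpace ℝ E]
    (M : Type*) [TopologicalSpace M] [ChartedSpace E M] : Set (TangentBundle 𝓘(ℝ, E) M) :=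
  {w | w.2 ≠ 0}

/-- A vector field `V` on `M` (`V x ∈ T_x M`) is smooth on the set `O`. -/
def SmoothFieldOn [IsManifold 𝓘(ℝ, E) ∞ M] (V : Π x : M, TangentSpace 𝓘(ℝ, E) x) (O : Set M) :
    Prop :=
  ContMDiffOn 𝓘(ℝ, E) 𝓘(ℝ, E).tangent ∞ (fun x => (⟨x, V x⟩ : TangentBundle 𝓘(ℝ, E) M)) O

section DoubleTangent

variable [IsManifold 𝓘(ℝ, E) ∞ M]

/-- The tangent space `T_w(TM)` of the manifold `TM` at `w`. -/
abbrev TT (w : TangentBundle 𝓘(ℝ, E) M) : Type _ := TangentSpace 𝓘(ℝ, E).tangent w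

/-- A vector field on `TM` is smooth on the set `O`. -/
def SmoothOn (X : Π w : TangentBundle 𝓘(ℝ, E) M, TT w) (O : Set (TangentBundle 𝓘(ℝ, E) M)) :
    Prop :=
  ContMDiffOn 𝓘(ℝ, E).tangent 𝓘(ℝ, E).tangent.tangent ∞
    (fun w => (⟨w, X w⟩ : TangentBundle 𝓘(ℝ, E).tangent (TangentBundle 𝓘(ℝ, E) M))) O

/-- A vector field on `TM` is smooth on some neighbourhood of `w`. -/
def SmoothNear (X : Π w : TangentBundle 𝓘(ℝ, E) M, TT w) (w : TangentBundle 𝓘(ℝ, E) M) : Prop :=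
  ∃ O ∈ 𝓝 w, SmoothOn X O

/-- The differential at `w` of the projection `π : TM → M`. -/
def dpi (w : TangentBundle 𝓘(ℝ, E) M) : TT w →L[ℝ] TangentSpace 𝓘(ℝ, E) w.1 :=
  mfderiv 𝓘(ℝ, E).tangent 𝓘(ℝ, E) (TotalSpace.proj : TangentBundle 𝓘(ℝ, E) M → M) w

/-- A vector of `T_w(TM)` is vertical if it lies in the kernel of `dπ`. -/
def IsVertical (w : TangentBundle 𝓘(ℝ, E) M) (ξ : TT w) : Prop := dpi w ξ = 0

/-- The vertical lift `i_w : T_{π(w)}M → T_w(TM)`, `i_w(u) = d/dt|_{t=0} (w + t u)`, that is, the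
differential at `w` of the inclusion into `TM` of the fibre through `w`. -/
def vlift (w : TangentBundle 𝓘(ℝ, E) M) : TangentSpace 𝓘(ℝ, E) w.1 →L[ℝ] TT w :=
  mfderiv 𝓘(ℝ, E) 𝓘(ℝ, E).tangent
    (fun v : E => (⟨w.1, v⟩ : TangentBundle 𝓘(ℝ, E) M)) w.2

/-- The inverse `i_w⁻¹` of the vertical lift, meaningful on vertical vectors. -/
def vliftInv (w : TangentBundle 𝓘(ℝ, E) M) : TT w → TangentSpace 𝓘(ℝ, E) w.1 :=
  Function.invFun (vlift w)

/-- The vertical lift `V^𝔳(w) = i_w(V(π(w)))` of a vector field `V` on `M`. -/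
def vliftField (V : Π x : M, TangentSpace 𝓘(ℝ, E) x) :
    Π w : TangentBundle 𝓘(ℝ, E) M, TT w :=
  fun w => vlift w (V w.1)

/-- The canonical vector field `C(w) = i_w(w)`. -/
def canonicalField : Π w : TangentBundle 𝓘(ℝ, E) M, TT w := fun w => vlift w w.2

/-- The almost-tangent structure `𝒥 = i_w ∘ dπ`. -/
def J (w : TangentBundle 𝓘(ℝ, E) M) : TT w →L[ℝ] TT w := (vlift w).comp (dpi w)

/-- `𝒥` applied to a vector field. -/
def JField (X : Π w : TangentBundle 𝓘(ℝ, E) M, TT w) : Π w : TangentBundle 𝓘(ℝ, E) M, TT w :=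
  fun w => J w (X w)

/-- The Lie bracket of vector fields on `TM`. -/
def bracket (X Y : Π w : TangentBundle 𝓘(ℝ, E) M, TT w) :
    Π w : TangentBundle 𝓘(ℝ, E) M, TT w :=
  VectorField.mlieBracket 𝓘(ℝ, E).tangent X Y

/-- The derivative at `w` of a function on `TM` in the direction `ξ ∈ T_w(TM)`. -/
def dirDeriv (f : TangentBundle 𝓘(ℝ, E) M → ℝ) (w : TangentBundle 𝓘(ℝ, E) M) (ξ : TT w) : ℝ :=
  mvfderiv 𝓘(ℝ, E).tangent f w ξ

/-! ### The canonical connection of a spray -/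

/-- The canonical connection `Γ_S = -[S, 𝒥]`, as an operator on vector fields:
`Γ_S(X) = -([S, 𝒥X] - 𝒥[S, X])`. -/
def canonicalConnField (S X : Π w : TangentBundle 𝓘(ℝ, E) M, TT w) :
    Π w : TangentBundle 𝓘(ℝ, E) M, TT w :=
  fun w => -(bracket S (JField X) w - J w (bracket S X w))

/-- The value of the tensor `Γ_S` on a vector `ξ ∈ T_w(TM)`, computed with the local extension of
`ξ` that is constant in the preferred trivialisation of `T(TM)` at `w` (since `Γ_S` is tensorial,
every smooth local extension gives the same value). -/
def canonicalConn (S : Π w : TangentBundle 𝓘(ℝ, E) M, TT w)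
    (w : TangentBundle 𝓘(ℝ, E) M) (ξ : TT w) : TT w :=
  canonicalConnField S (FiberBundle.extend (E × E) ξ) w

/-- The vertical projector `𝒱 = (I - Γ_S)/2` along the horizontal distribution `ker (Γ_S - I)`. -/
def vproj (S : Π w : TangentBundle 𝓘(ℝ, E) M, TT w)
    (w : TangentBundle 𝓘(ℝ, E) M) (ξ : TT w) : TT w :=
  (1 / 2 : ℝ) • (ξ - canonicalConn S w ξ)

/-- A vector of `T_w(TM)` is horizontal if it lies in `ker (Γ_S - I)`. -/
def IsHorizontal (S : Π w : TangentBundle 𝓘(ℝ, E) M, TT w)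
    (w : TangentBundle 𝓘(ℝ, E) M) (ξ : TT w) : Prop :=
  canonicalConn S w ξ = ξ

/-- The horizontal lift of `u ∈ T_{π(w)}M` at `w`: the (unique) horizontal vector of `T_w(TM)`
that projects onto `u`. -/
def hlift (S : Π w : TangentBundle 𝓘(ℝ, E) M, TT w)
    (w : TangentBundle 𝓘(ℝ, E) M) (u : TangentSpace 𝓘(ℝ, E) w.1) : TT w :=
  Classical.epsilon fun ξ : TT w => IsHorizontal S w ξ ∧ dpi w ξ = u

/-- `γ` is a geodesic of `S` on `I`: its velocity `t ↦ γ'(t)` is an integral curve of `S` in the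
slit tangent bundle. -/
def IsGeodesicOn (S : Π w : TangentBundle 𝓘(ℝ, E) M, TT w) (γ : ℝ → M) (I : Set ℝ) : Prop :=
  (∀ t ∈ I, (⟨γ t, mfderiv 𝓘(ℝ, ℝ) 𝓘(ℝ, E) γ t (1 : ℝ)⟩ : TangentBundle 𝓘(ℝ, E) M) ∈ slit E M) ∧
  IsMIntegralCurveOn (I := 𝓘(ℝ, E).tangent)
    (fun t => (⟨γ t, mfderiv 𝓘(ℝ, ℝ) 𝓘(ℝ, E) γ t (1 : ℝ)⟩ : TangentBundle 𝓘(ℝ, E) M)) S I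

/-! ### Linear connections on the vertical tangent bundle -/

/-- `Y` is a smooth section of the vertical tangent bundle near `w`. -/
def VertSectionNear (Y : Π w : TangentBundle 𝓘(ℝ, E) M, TT w) (w : TangentBundle 𝓘(ℝ, E) M) :
    Prop :=
  SmoothNear Y w ∧ ∀ᶠ v in 𝓝 w, IsVertical v (Y v)

end DoubleTangent

/-- A (smooth) linear connection on the vertical tangent bundle `𝒱TM → TM ∖ 0`, as a covariant
derivative on local smooth sections: `nabla Y w ξ` is `∇_ξ Y` for `w ∈ TM ∖ 0`, `ξ ∈ T_w(TM)` and
`Y` a smooth section of the vertical bundle near `w`. -/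
structure VerticalConnection (E : Type*) [NormedAddCommGroup E] [NormedSpace ℝ E]
    (M : Type*) [TopologicalSpace M] [ChartedSpace E M] [IsManifold 𝓘(ℝ, E) ∞ M] where
  nabla : (Π w : TangentBundle 𝓘(ℝ, E) M, TT w) → Π w : TangentBundle 𝓘(ℝ, E) M, TT w →L[ℝ] TT w
  vertical : ∀ w ∈ slit E M, ∀ Y, VertSectionNear Y w → ∀ ξ : TT w, IsVertical w (nabla Y w ξ)
  add : ∀ w ∈ slit E M, ∀ Y Z, VertSectionNear Y w → VertSectionNear Z w →
    ∀ ξ : TT w, nabla (fun v => Y v + Z v) w ξ = nabla Y w ξ + nabla Z w ξ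
  leibniz : ∀ w ∈ slit E M, ∀ (f : TangentBundle 𝓘(ℝ, E) M → ℝ) (Y),
    (∃ O ∈ 𝓝 w, ContMDiffOn 𝓘(ℝ, E).tangent 𝓘(ℝ, ℝ) ∞ f O) → VertSectionNear Y w →
    ∀ ξ : TT w, nabla (fun v => f v • Y v) w ξ = dirDeriv f w ξ • Y w + f w • nabla Y w ξ
  smooth : ∀ O : Set (TangentBundle 𝓘(ℝ, E) M), IsOpen O → O ⊆ slit E M → ∀ X Y,
    SmoothOn X O → SmoothOn Y O → (∀ w ∈ O, IsVertical w (Y w)) →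
    SmoothOn (fun w => nabla Y w (X w)) O

section Connections

variable [IsManifold 𝓘(ℝ, E) ∞ M]

/-- `∇` is a lift of (projects onto) `Γ_S`: `∇_ξ C = 𝒱ξ` for all `ξ ∈ T(TM ∖ 0)`. -/
def IsLift (S : Π w : TangentBundle 𝓘(ℝ, E) M, TT w) (D : VerticalConnection E M) : Prop :=
  ∀ w ∈ slit E M, ∀ ξ : TT w, D.nabla canonicalField w ξ = vproj S w ξ

/-- The torsion `T(X, Y) = ∇_X 𝒥Y - ∇_Y 𝒥X - 𝒥[X, Y]`. -/
def torsion (D : VerticalConnection E M) (X Y : Π w : TangentBundle 𝓘(ℝ, E) M, TT w) :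
    Π w : TangentBundle 𝓘(ℝ, E) M, TT w :=
  fun w => D.nabla (JField Y) w (X w) - D.nabla (JField X) w (Y w) - J w (bracket X Y w)

/-- Condition (T1): `T(S, Y) = 0` for all `Y`. -/
def CondT1 (S : Π w : TangentBundle 𝓘(ℝ, E) M, TT w) (D : VerticalConnection E M) : Prop :=
  ∀ w ∈ slit E M, ∀ Y, SmoothNear Y w → torsion D S Y w = 0

/-- The tensor `𝒞(X, Y) = T(𝒥X, Y)`. -/
def calC (D : VerticalConnection E M) (X Y : Π w : TangentBundle 𝓘(ℝ, E) M, TT w) :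
    Π w : TangentBundle 𝓘(ℝ, E) M, TT w :=
  torsion D (JField X) Y

/-- `D^w_u V = i_w⁻¹ ∇_{u^𝔥} V^𝔳`, where `u^𝔥` is the horizontal lift of `u` at `w`. -/
def affineAt (S : Π w : TangentBundle 𝓘(ℝ, E) M, TT w) (D : VerticalConnection E M)
    (w : TangentBundle 𝓘(ℝ, E) M) (u : TangentSpace 𝓘(ℝ, E) w.1)
    (V : Π x : M, TangentSpace 𝓘(ℝ, E) x) : TangentSpace 𝓘(ℝ, E) w.1 :=
  vliftInv w (D.nabla (vliftField V) w (hlift S w u))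

/-- The affine connection `(D^W_U V)(x) = D^{W(x)}_{U(x)} V`. -/
def affineConn (S : Π w : TangentBundle 𝓘(ℝ, E) M, TT w) (D : VerticalConnection E M)
    (W U V : Π x : M, TangentSpace 𝓘(ℝ, E) x) : Π x : M, TangentSpace 𝓘(ℝ, E) x :=
  fun x => affineAt S D (⟨x, W x⟩ : TangentBundle 𝓘(ℝ, E) M) (U x) V

end Connections

/-! ### Finsler metrics -/

/-- The fundamental tensor `g_w(u, v) = (1/2) ∂²/∂t∂s|_{(0,0)} F(w + s u + t v)²`. -/
def fundamentalTensor (F : TangentBundle 𝓘(ℝ, E) M → ℝ) (w : TangentBundle 𝓘(ℝ, E) M)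
    (u v : TangentSpace 𝓘(ℝ, E) w.1) : ℝ :=
  (1 / 2 : ℝ) * deriv (fun t : ℝ => deriv (fun s : ℝ =>
    F (⟨w.1, w.2 + s • u + t • v⟩ : TangentBundle 𝓘(ℝ, E) M) ^ 2) 0) 0

/-- A Finsler metric on `M`. -/
structure FinslerMetric (E : Type*) [NormedAddCommGroup E] [NormedSpace ℝ E]
    (M : Type*) [TopologicalSpace M] [ChartedSpace E M] [IsManifold 𝓘(ℝ, E) ∞ M] where
  toFun : TangentBundle 𝓘(ℝ, E) M → ℝ
  nonneg : ∀ w, 0 ≤ toFun w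
  smooth : ContMDiffOn 𝓘(ℝ, E).tangent 𝓘(ℝ, ℝ) ∞ toFun (slit E M)
  eq_zero_iff : ∀ w, toFun w = 0 ↔ w.2 = 0
  homogeneous : ∀ (x : M) (u : TangentSpace 𝓘(ℝ, E) x) (c : ℝ), 0 < c →
    toFun ⟨x, c • u⟩ = c * toFun ⟨x, u⟩
  posDef : ∀ w ∈ slit E M, ∀ u : TangentSpace 𝓘(ℝ, E) w.1, u ≠ 0 →
    0 < fundamentalTensor toFun w u u

section Metric

variable [IsManifold 𝓘(ℝ, E) ∞ M]

/-- The fundamental tensor `g_w` of a Finsler metric. -/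
def FinslerMetric.g (F : FinslerMetric E M) (w : TangentBundle 𝓘(ℝ, E) M)
    (u v : TangentSpace 𝓘(ℝ, E) w.1) : ℝ :=
  fundamentalTensor F.toFun w u v

/-- The function `g_W(V, T)` on `M`, for vector fields `W, V, T`. -/
def FinslerMetric.gAlong (F : FinslerMetric E M) (W V T : Π x : M, TangentSpace 𝓘(ℝ, E) x) :
    M → ℝ :=
  fun x => F.g (⟨x, W x⟩ : TangentBundle 𝓘(ℝ, E) M) (V x) (T x)

/-- The metric induced by `g` on the vertical tangent bundle with the help of the vertical lift. -/
def FinslerMetric.gVert (F : FinslerMetric E M) (w : TangentBundle 𝓘(ℝ, E) M) (ξ η : TT w) : ℝ :=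
  F.g w (vliftInv w ξ) (vliftInv w η)

/-- The energy function `F²/2`. -/
def FinslerMetric.energy (F : FinslerMetric E M) : TangentBundle 𝓘(ℝ, E) M → ℝ :=
  fun w => (1 / 2 : ℝ) * F.toFun w ^ 2

/-- The pull-back `θ_w(ξ) = g_w(w, dπ ξ)` of the canonical 1-form of `T*M` by the Legendre
transformation `w ↦ g_w(w, ·)`. -/
def FinslerMetric.theta (F : FinslerMetric E M) (w : TangentBundle 𝓘(ℝ, E) M) (ξ : TT w) : ℝ :=
  F.g w w.2 (dpi w ξ)

/-- The symplectic form `ω_F = -dθ` on `TM ∖ 0`, evaluated on vector fields. It is the pull-back of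
the canonical symplectic form `∑ dqⁱ ∧ dpᵢ` of `T*M` by the Legendre transformation. -/
def FinslerMetric.omega (F : FinslerMetric E M) (X Y : Π w : TangentBundle 𝓘(ℝ, E) M, TT w)
    (w : TangentBundle 𝓘(ℝ, E) M) : ℝ :=
  -(dirDeriv (fun v => F.theta v (Y v)) w (X w) - dirDeriv (fun v => F.theta v (X v)) w (Y w)
    - F.theta w (bracket X Y w))

/-- `S` is the geodesic spray of `F`: the smooth vector field on `TM ∖ 0` with
`d(F²/2) = ω_F(S, ·)`. -/
def IsGeodesicSpray (F : FinslerMetric E M) (S : Π w : TangentBundle 𝓘(ℝ, E) M, TT w) : Prop :=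
  SmoothOn S (slit E M) ∧
  ∀ w ∈ slit E M, ∀ Y, SmoothNear Y w → dirDeriv F.energy w (Y w) = F.omega S Y w

/-- Condition (M1): `(∇_ξ g)(Y, C) = 0`, for all vectors `ξ` and vertical `Y`. -/
def CondM1 (F : FinslerMetric E M) (D : VerticalConnection E M) : Prop :=
  ∀ w ∈ slit E M, ∀ (ξ : TT w) (Y), VertSectionNear Y w →
    dirDeriv (fun v => F.gVert v (Y v) (canonicalField v)) w ξ
      - F.gVert w (D.nabla Y w ξ) (canonicalField w)
      - F.gVert w (Y w) (D.nabla canonicalField w ξ) = 0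

/-- Condition (M2): `𝒞_♭(X, Y, S) = g(𝒞(X, Y), 𝒥S) = 0`, for all `X, Y`. -/
def CondM2 (F : FinslerMetric E M) (S : Π w : TangentBundle 𝓘(ℝ, E) M, TT w)
    (D : VerticalConnection E M) : Prop :=
  ∀ w ∈ slit E M, ∀ X Y, SmoothNear X w → SmoothNear Y w →
    F.gVert w (calC D X Y w) (J w (S w)) = 0

end Metric

end

end FinslerConn

namespace FinslerConn

noncomputable section

variable {E : Type*} [NormedAddCommGroup E] [NormedSpace ℝ E]
  {M : Type*} [TopologicalSpace M] [ChartedSpace E M]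

/-! In a natural chart `(x, y)` of `TM`, write `L` for the energy, `H` for its second derivative and
`σ = (y, σ₂)` for the spray. The metric is the restriction of `H` to vertical vectors, and the
horizontal lift of `u` is `(u, ½ ∂_yσ₂ u)`. Both parts compare derivatives of `H` with covariant
derivatives at the point `W(x)`.

(i) By the chain rule `U g_W(W, V)` is the derivative of `g(V^𝔳, C)` along `ξ = dW(U)`, because `C`
and `W^𝔳` agree on the image of `W`. (M1) turns it into `g(∇_ξ V^𝔳, C) + g(V^𝔳, ∇_ξ C)`. The lift
property gives `∇_ξ C = 𝒱ξ`; this equals `∇_{U^𝔥} W^𝔳`, since `W^𝔳 - C` vanishes at `W(x)` and its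
covariant derivative there is an ordinary derivative (`nabla_vliftField_self`). Split `ξ` into `U^𝔥`
and a vertical part: the vertical part differentiates `V^𝔳` to a value of `𝒞`, which (M2) makes
orthogonal to `𝒥S = C` (`hessian_nabla_vertical_eq_zero`).

(ii) (T1) and the lift property determine `∇_S V^𝔳`: it is represented by `∂_y V - ½ ∂_Vσ₂`, where
`∂_y V` is the derivative of `V` in the direction `y` and `∂_V` differentiates in the fibre
direction `V` (`nabla_vliftField_spray`). Homogeneity makes `S` horizontal, so this is `D^W_W V` at
`W`. The geodesic hypothesis says that `S` is tangent to the image of `W`, so the derivative of `H`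
that occurs is the one along `σ`. It is governed by `IsSprayNear.metric`, the symmetrised vertical
derivative of the Euler-Lagrange equation. -/

/-! ### Natural charts of the tangent bundle -/

/-- The differential at `x` of the inverse of the chart of `M` at `x₀`. -/
def frame (x₀ : M) (x : E) : E →L[ℝ] TangentSpace 𝓘(ℝ, E) ((chartAt E x₀).symm x) :=
  mfderiv 𝓘(ℝ, E) 𝓘(ℝ, E) (chartAt E x₀).symm x

/-- The inverse of the natural chart of `TM` over the domain of the chart of `M` at `x₀`. -/
def param (x₀ : M) (p : E × E) : TangentBundle 𝓘(ℝ, E) M :=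
  ⟨(chartAt E x₀).symm p.1, frame x₀ p.1 p.2⟩

/-- The domain of `param`. -/
def paramDom (x₀ : M) : Set (E × E) := (chartAt E x₀).target ×ˢ univ

omit [NormedSpace ℝ E] in
lemma isOpen_paramDom (x₀ : M) : IsOpen (paramDom (E := E) x₀) :=
  (chartAt E x₀).open_target.prod isOpen_univ

section

variable [IsManifold 𝓘(ℝ, E) ∞ M]

/-- The differential of `param`. -/
def dparam (x₀ : M) (p : E × E) : E × E →L[ℝ] TT (param x₀ p) :=
  mfderiv 𝓘(ℝ, E × E) 𝓘(ℝ, E).tangent (param x₀) p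

lemma extChartAt_symm_eq_param (w₀ : TangentBundle 𝓘(ℝ, E) M) {p : E × E}
    (hp : p ∈ paramDom w₀.1) :
    (extChartAt 𝓘(ℝ, E).tangent w₀).symm p = param w₀.1 p := by
  have := tangentMap_chart_symm (I := 𝓘(ℝ, E)) (p := w₀) (q := ⟨p.1, p.2⟩) hp.1
  rw [param, frame]
  exact this.symm

lemma extChartAt_target_eq (w₀ : TangentBundle 𝓘(ℝ, E) M) :
    (extChartAt 𝓘(ℝ, E).tangent w₀).target = paramDom w₀.1 := by
  ext p
  have := TangentBundle.mem_chart_target_iff (I := 𝓘(ℝ, E)) p w₀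
  simp only [paramDom, mem_prod, mem_univ, and_true, ← this, extChartAt]
  simp
  exact this

lemma extChartAt_source_eq (w₀ : TangentBundle 𝓘(ℝ, E) M) :
    (extChartAt 𝓘(ℝ, E).tangent w₀).source = {w | w.1 ∈ (chartAt E w₀.1).source} := by
  ext p
  simp

lemma contMDiffAt_param {x₀ : M} {p : E × E} (hp : p ∈ paramDom x₀) :
    ContMDiffAt 𝓘(ℝ, E × E) 𝓘(ℝ, E).tangent ∞ (param x₀) p := by
  have h := contMDiffOn_extChartAt_symm (I := 𝓘(ℝ, E).tangent) (n := ∞)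
    (⟨x₀, 0⟩ : TangentBundle 𝓘(ℝ, E) M)
  rw [extChartAt_target_eq] at h
  refine (h.contMDiffAt ((isOpen_paramDom x₀).mem_nhds hp)).congr_of_eventuallyEq ?_
  filter_upwards [(isOpen_paramDom x₀).mem_nhds hp] with q hq
  exact (extChartAt_symm_eq_param ⟨x₀, 0⟩ hq).symm

lemma mdifferentiableAt_param {x₀ : M} {p : E × E} (hp : p ∈ paramDom x₀) :
    MDifferentiableAt 𝓘(ℝ, E × E) 𝓘(ℝ, E).tangent (param x₀) p :=
  (contMDiffAt_param hp).mdifferentiableAt (by simp)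

lemma param_eventuallyEq (w₀ : TangentBundle 𝓘(ℝ, E) M) {p : E × E} (hp : p ∈ paramDom w₀.1) :
    param w₀.1 =ᶠ[𝓝 p] (extChartAt 𝓘(ℝ, E).tangent w₀).symm := by
  filter_upwards [(isOpen_paramDom w₀.1).mem_nhds hp] with q hq
  exact (extChartAt_symm_eq_param w₀ hq).symm

lemma isInvertible_dparam {x₀ : M} {p : E × E} (hp : p ∈ paramDom x₀) :
    (dparam x₀ p).IsInvertible := by
  have h := isInvertible_mfderivWithin_extChartAt_symm (I := 𝓘(ℝ, E).tangent)
    (x := (⟨x₀, 0⟩ : TangentBundle 𝓘(ℝ, E) M)) (y := p) (by rwa [extChartAt_target_eq])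
  have h2 : range 𝓘(ℝ, E).tangent = univ := ModelWithCorners.range_eq_univ _
  rw [h2, mfderivWithin_univ, ← (param_eventuallyEq ⟨x₀, 0⟩ hp).mfderiv_eq] at h
  exact h

lemma isInvertible_frame {x₀ : M} {x : E} (hx : x ∈ (chartAt E x₀).target) :
    (frame x₀ x).IsInvertible := by
  have h := isInvertible_mfderivWithin_extChartAt_symm (I := 𝓘(ℝ, E)) (x := x₀) (y := x)
    (by simpa using hx)
  have h2 : range 𝓘(ℝ, E) = univ := ModelWithCorners.range_eq_univ _
  rw [h2, mfderivWithin_univ] at h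
  have h3 : ((extChartAt 𝓘(ℝ, E) x₀).symm : E → M) = (chartAt E x₀).symm := by
    simp only [mfld_simps]
  rw [h3] at h
  exact h

lemma hasMFDerivAt_chart_symm {x₀ : M} {x : E} (hx : x ∈ (chartAt E x₀).target) :
    HasMFDerivAt 𝓘(ℝ, E) 𝓘(ℝ, E) (chartAt E x₀).symm x (frame x₀ x) :=
  (mdifferentiableAt_atlas_symm (chart_mem_atlas _ _) hx).hasMFDerivAt

lemma hasMFDerivAt_param {x₀ : M} {p : E × E} (hp : p ∈ paramDom x₀) :
    HasMFDerivAt 𝓘(ℝ, E × E) 𝓘(ℝ, E).tangent (param x₀) p (dparam x₀ p) :=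
  (mdifferentiableAt_param hp).hasMFDerivAt

lemma dpi_dparam {x₀ : M} {p : E × E} (hp : p ∈ paramDom x₀) (q : E × E) :
    dpi (param x₀ p) (dparam x₀ p q) = frame x₀ p.1 q.1 := by
  have h1 : HasMFDerivAt 𝓘(ℝ, E × E) 𝓘(ℝ, E)
      ((TotalSpace.proj : TangentBundle 𝓘(ℝ, E) M → M) ∘ param x₀) p
      ((dpi (param x₀ p)).comp (dparam x₀ p)) :=
    HasMFDerivAt.comp p
      (contMDiff_proj (n := 1) (TangentSpace 𝓘(ℝ, E) : M → Type _)
        |>.mdifferentiableAt (by simp)).hasMFDerivAt (hasMFDerivAt_param hp)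
  have h2 : HasMFDerivAt 𝓘(ℝ, E × E) 𝓘(ℝ, E)
      ((chartAt E x₀).symm ∘ (Prod.fst : E × E → E)) p
      ((frame x₀ p.1).comp (ContinuousLinearMap.fst ℝ E E)) :=
    HasMFDerivAt.comp p (hasMFDerivAt_chart_symm hp.1)
      (hasFDerivAt_fst (𝕜 := ℝ) (p := p)).hasMFDerivAt
  exact DFunLike.congr_fun (hasMFDerivAt_unique h1 h2) q

/-- Precomposing the fibre inclusion with the linear map `frame` gives `v ↦ param x₀ (p.1, v)`, so
the vertical lift becomes the partial derivative of `param` in the second slot. -/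
lemma vlift_frame {x₀ : M} {p : E × E} (hp : p ∈ paramDom x₀) (v : E) :
    vlift (param x₀ p) (frame x₀ p.1 v) = dparam x₀ p (0, v) := by
  obtain ⟨A, hA⟩ : ∃ A : E ≃L[ℝ] E, (A : E →L[ℝ] E) = frame x₀ p.1 := isInvertible_frame hp.1
  let L : E →L[ℝ] E := frame x₀ p.1
  let y : E := frame x₀ p.1 p.2
  have h1 (z : E) : HasMFDerivAt 𝓘(ℝ, E) 𝓘(ℝ, E).tangent (fun v : E => param x₀ (p.1, v)) z
      ((dparam x₀ (p.1, z)).comp (ContinuousLinearMap.inr ℝ E E)) :=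
    HasMFDerivAt.comp (f := fun v : E => (p.1, v)) (g := param x₀) z
      (hasMFDerivAt_param (p := (p.1, z)) ⟨hp.1, mem_univ _⟩)
      ((hasFDerivAt_prodMk_right (𝕜 := ℝ) p.1 z).hasMFDerivAt)
  -- `vlift` is an `mfderiv`, which would be zero at a point of non-differentiability; the inverse
  -- of `frame` expresses the fibre inclusion through `param`.
  have h2 : MDifferentiableAt 𝓘(ℝ, E) 𝓘(ℝ, E).tangent
      (fun v : E => (⟨(param x₀ p).1, v⟩ : TangentBundle 𝓘(ℝ, E) M)) y := by
    have h3 : HasMFDerivAt 𝓘(ℝ, E) 𝓘(ℝ, E).tangent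
        ((fun v : E => param x₀ (p.1, v)) ∘ A.symm) y _ :=
      HasMFDerivAt.comp y (h1 _) (A.symm.hasFDerivAt (x := y)).hasMFDerivAt
    refine (h3.congr_of_eventuallyEq ?_).mdifferentiableAt
    refine Filter.Eventually.of_forall fun u => ?_
    simp only [Function.comp, param, ← hA]
    congr 1
    exact (A.apply_symm_apply u).symm
  have h4 : HasMFDerivAt 𝓘(ℝ, E) 𝓘(ℝ, E).tangent
      ((fun v : E => (⟨(param x₀ p).1, v⟩ : TangentBundle 𝓘(ℝ, E) M)) ∘ L) p.2
      ((vlift (param x₀ p)).comp L) :=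
    HasMFDerivAt.comp p.2 h2.hasMFDerivAt (L.hasFDerivAt (x := p.2)).hasMFDerivAt
  exact DFunLike.congr_fun (hasMFDerivAt_unique h4 (h1 p.2)) v

lemma J_dparam {x₀ : M} {p : E × E} (hp : p ∈ paramDom x₀) (q : E × E) :
    J (param x₀ p) (dparam x₀ p q) = dparam x₀ p (0, q.1) := by
  rw [J, ContinuousLinearMap.comp_apply, dpi_dparam hp, vlift_frame hp]

lemma dparam_injective {x₀ : M} {p : E × E} (hp : p ∈ paramDom x₀) :
    Function.Injective (dparam x₀ p) :=
  (isInvertible_dparam hp).injective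

lemma frame_injective {x₀ : M} {x : E} (hx : x ∈ (chartAt E x₀).target) :
    Function.Injective (frame x₀ x) :=
  (isInvertible_frame hx).injective

lemma exists_dparam_eq {x₀ : M} {p : E × E} (hp : p ∈ paramDom x₀) (ξ : TT (param x₀ p)) :
    ∃ q, dparam x₀ p q = ξ :=
  (isInvertible_dparam hp).surjective ξ

lemma exists_frame_eq {x₀ : M} {x : E} (hx : x ∈ (chartAt E x₀).target)
    (u : TangentSpace 𝓘(ℝ, E) ((chartAt E x₀).symm x)) : ∃ v, frame x₀ x v = u :=
  (isInvertible_frame hx).surjective u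

lemma isVertical_dparam {x₀ : M} {p : E × E} (hp : p ∈ paramDom x₀) (q : E × E) :
    IsVertical (param x₀ p) (dparam x₀ p q) ↔ q.1 = 0 := by
  rw [IsVertical, dpi_dparam hp]
  exact (frame_injective hp.1).eq_iff' (map_zero _)

lemma vlift_injective {x₀ : M} {p : E × E} (hp : p ∈ paramDom x₀) :
    Function.Injective (vlift (param x₀ p)) := by
  intro u v h
  obtain ⟨u, rfl⟩ := exists_frame_eq hp.1 u
  obtain ⟨v, rfl⟩ := exists_frame_eq hp.1 v
  rw [vlift_frame hp, vlift_frame hp] at h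
  have := dparam_injective hp h
  simp only [Prod.mk.injEq, true_and] at this
  rw [this]

lemma vliftInv_dparam {x₀ : M} {p : E × E} (hp : p ∈ paramDom x₀) (v : E) :
    vliftInv (param x₀ p) (dparam x₀ p (0, v)) = frame x₀ p.1 v := by
  rw [← vlift_frame hp]
  exact Function.leftInverse_invFun (vlift_injective hp) _

lemma canonicalField_param {x₀ : M} {p : E × E} (hp : p ∈ paramDom x₀) :
    canonicalField (param x₀ p) = dparam x₀ p (0, p.2) := vlift_frame hp p.2

lemma mem_slit_param {x₀ : M} {p : E × E} (hp : p ∈ paramDom x₀) :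
    param x₀ p ∈ slit E M ↔ p.2 ≠ 0 :=
  not_congr ((frame_injective hp.1).eq_iff' (map_zero _))

end

/-! ### Functions and vector fields on `TM` in natural charts -/

section

variable [IsManifold 𝓘(ℝ, E) ∞ M]

/-- `param` agrees near `p` with the inverse of a chart. This carries germ conditions between `TM`
and `E × E`. -/
lemma map_param_nhds {x₀ : M} {p : E × E} (hp : p ∈ paramDom x₀) :
    Filter.map (param x₀) (𝓝 p) = 𝓝 (param x₀ p) := by
  let w₀ : TangentBundle 𝓘(ℝ, E) M := ⟨x₀, 0⟩
  have h := (chartAt (ModelProd E E) w₀).symm.map_nhds_eq (x := p)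
    ((TangentBundle.mem_chart_target_iff (I := 𝓘(ℝ, E)) p w₀).2 hp.1)
  have h1 : ∀ q ∈ paramDom (E := E) x₀, (chartAt (ModelProd E E) w₀).symm q = param x₀ q :=
    fun q hq => extChartAt_symm_eq_param w₀ hq
  rw [h1 p hp] at h
  rw [← h]
  refine Filter.map_congr ?_
  filter_upwards [(isOpen_paramDom x₀).mem_nhds hp] with q hq
  exact (h1 q hq).symm

lemma eventually_param {x₀ : M} {p : E × E} (hp : p ∈ paramDom x₀)
    {P : TangentBundle 𝓘(ℝ, E) M → Prop} :
    (∀ᶠ w in 𝓝 (param x₀ p), P w) ↔ ∀ᶠ q in 𝓝 p, P (param x₀ q) := by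
  rw [← map_param_nhds hp, Filter.eventually_map]

lemma extChartAt_param {x₀ : M} {p : E × E} (hp : p ∈ paramDom x₀) :
    extChartAt 𝓘(ℝ, E).tangent (⟨x₀, 0⟩ : TangentBundle 𝓘(ℝ, E) M) (param x₀ p) = p := by
  rw [← extChartAt_symm_eq_param ⟨x₀, 0⟩ hp]
  exact PartialEquiv.right_inv _ (by rwa [extChartAt_target_eq])

lemma param_mem_source {x₀ : M} {p : E × E} (hp : p ∈ paramDom x₀) :
    param x₀ p ∈ (extChartAt 𝓘(ℝ, E).tangent (⟨x₀, 0⟩ : TangentBundle 𝓘(ℝ, E) M)).source := by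
  rw [extChartAt_source_eq]
  exact (chartAt E x₀).map_target hp.1

lemma hasMFDerivAt_extChartAt_param {x₀ : M} {p : E × E} (hp : p ∈ paramDom x₀) :
    HasMFDerivAt 𝓘(ℝ, E).tangent 𝓘(ℝ, E × E)
      (extChartAt 𝓘(ℝ, E).tangent (⟨x₀, 0⟩ : TangentBundle 𝓘(ℝ, E) M)) (param x₀ p)
      (mfderiv 𝓘(ℝ, E).tangent 𝓘(ℝ, E × E)
        (extChartAt 𝓘(ℝ, E).tangent (⟨x₀, 0⟩ : TangentBundle 𝓘(ℝ, E) M)) (param x₀ p)) :=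
  (mdifferentiableAt_extChartAt (by
    rw [← extChartAt_source 𝓘(ℝ, E).tangent]; exact param_mem_source hp)).hasMFDerivAt

lemma mfderiv_extChartAt_dparam {x₀ : M} {p : E × E} (hp : p ∈ paramDom x₀) (q : E × E) :
    (mfderiv 𝓘(ℝ, E).tangent 𝓘(ℝ, E × E)
      (extChartAt 𝓘(ℝ, E).tangent (⟨x₀, 0⟩ : TangentBundle 𝓘(ℝ, E) M)) (param x₀ p))
        (dparam x₀ p q) = q := by
  have h1 := HasMFDerivAt.comp p (hasMFDerivAt_extChartAt_param hp) (hasMFDerivAt_param hp)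
  have h2 : HasMFDerivAt 𝓘(ℝ, E × E) 𝓘(ℝ, E × E)
      (extChartAt 𝓘(ℝ, E).tangent (⟨x₀, 0⟩ : TangentBundle 𝓘(ℝ, E) M) ∘ param x₀) p
      (ContinuousLinearMap.id ℝ (E × E)) := by
    refine (hasMFDerivAt_id p).congr_of_eventuallyEq ?_
    filter_upwards [(isOpen_paramDom x₀).mem_nhds hp] with r hr
    exact extChartAt_param hr
  exact DFunLike.congr_fun (hasMFDerivAt_unique h1 h2) q

/-- The vector field `X` on `TM` is given near `param x₀ p` by the smooth map `ξ`. -/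
def IsRep (x₀ : M) (X : Π w : TangentBundle 𝓘(ℝ, E) M, TT w) (ξ : E × E → E × E) (p : E × E) :
    Prop :=
  (∀ᶠ q in 𝓝 p, ContDiffAt ℝ ∞ ξ q) ∧ ∀ᶠ q in 𝓝 p, X (param x₀ q) = dparam x₀ q (ξ q)

/-- The vector field on `TM` with coordinate expression `ξ`. -/
def pushField (x₀ : M) (ξ : E × E → E × E) (w : TangentBundle 𝓘(ℝ, E) M) : TT w :=
  VectorField.mpullback 𝓘(ℝ, E).tangent 𝓘(ℝ, E × E)
    (extChartAt 𝓘(ℝ, E).tangent (⟨x₀, 0⟩ : TangentBundle 𝓘(ℝ, E) M)) ξ w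

/-- The coordinate expression of a vector field on `TM`. -/
def pullField (x₀ : M) (X : Π w : TangentBundle 𝓘(ℝ, E) M, TT w) (p : E × E) : E × E :=
  VectorField.mpullback 𝓘(ℝ, E × E) 𝓘(ℝ, E).tangent (param x₀) X p

lemma pushField_param {x₀ : M} {p : E × E} (hp : p ∈ paramDom x₀) (ξ : E × E → E × E) :
    pushField x₀ ξ (param x₀ p) = dparam x₀ p (ξ p) := by
  have h := isInvertible_mfderiv_extChartAt (I := 𝓘(ℝ, E).tangent) (param_mem_source hp)
  have h1 := (mfderiv_extChartAt_dparam hp (ξ p)).trans (congrArg ξ (extChartAt_param hp).symm)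
  exact (congrArg _ h1.symm).trans (h.inverse_apply_self _)

lemma dparam_pullField {x₀ : M} {p : E × E} (hp : p ∈ paramDom x₀)
    (X : Π w : TangentBundle 𝓘(ℝ, E) M, TT w) :
    dparam x₀ p (pullField x₀ X p) = X (param x₀ p) := by
  obtain ⟨A, hA⟩ := isInvertible_dparam hp
  rw [pullField, VectorField.mpullback_apply]
  change dparam x₀ p ((dparam x₀ p).inverse _) = _
  rw [← hA, ContinuousLinearMap.inverse_equiv]
  exact A.apply_symm_apply _

lemma pullField_eq {x₀ : M} {p : E × E} (hp : p ∈ paramDom x₀)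
    {X : Π w : TangentBundle 𝓘(ℝ, E) M, TT w} {q : E × E}
    (h : X (param x₀ p) = dparam x₀ p q) : pullField x₀ X p = q :=
  dparam_injective hp ((dparam_pullField hp X).trans h)

lemma IsRep.self {x₀ : M} {X : Π w : TangentBundle 𝓘(ℝ, E) M, TT w} {ξ : E × E → E × E}
    {p : E × E} (h : IsRep x₀ X ξ p) : X (param x₀ p) = dparam x₀ p (ξ p) := h.2.self_of_nhds

lemma IsRep.contDiffAt {x₀ : M} {X : Π w : TangentBundle 𝓘(ℝ, E) M, TT w} {ξ : E × E → E × E}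
    {p : E × E} (h : IsRep x₀ X ξ p) : ContDiffAt ℝ ∞ ξ p := h.1.self_of_nhds

/-- Smoothness of order `∞` at a single point need not persist nearby; persistence holds because
`IsRep` asks for it on a neighbourhood. -/
lemma IsRep.eventually {x₀ : M} {X : Π w : TangentBundle 𝓘(ℝ, E) M, TT w} {ξ : E × E → E × E}
    {p : E × E} (h : IsRep x₀ X ξ p) : ∀ᶠ q in 𝓝 p, IsRep x₀ X ξ q := by
  filter_upwards [h.1.eventually_nhds, h.2.eventually_nhds] with q h1 h2 using ⟨h1, h2⟩

variable [FiniteDimensional ℝ E]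

lemma contMDiffAt_pushField {x₀ : M} {p : E × E} (hp : p ∈ paramDom x₀) {ξ : E × E → E × E}
    (hξ : ContDiffAt ℝ ∞ ξ p) :
    ContMDiffAt 𝓘(ℝ, E).tangent 𝓘(ℝ, E).tangent.tangent ∞
      (fun w => (⟨w, pushField x₀ ξ w⟩ :
        TangentBundle 𝓘(ℝ, E).tangent (TangentBundle 𝓘(ℝ, E) M))) (param x₀ p) := by
  have := FiniteDimensional.complete ℝ E
  refine ContMDiffAt.mpullback_vectorField_preimage (n := ∞) ?_ (contMDiffAt_extChartAt' (by
    rw [← extChartAt_source 𝓘(ℝ, E).tangent]; exact param_mem_source hp))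
    (isInvertible_mfderiv_extChartAt (param_mem_source hp)) (by simp)
  rw [extChartAt_param hp]
  exact contMDiffAt_vectorSpace_iff_contDiffAt.2 hξ

lemma contDiffAt_pullField {x₀ : M} {p : E × E} (hp : p ∈ paramDom x₀)
    {X : Π w : TangentBundle 𝓘(ℝ, E) M, TT w}
    (hX : ContMDiffAt 𝓘(ℝ, E).tangent 𝓘(ℝ, E).tangent.tangent ∞
      (fun w => (⟨w, X w⟩ : TangentBundle 𝓘(ℝ, E).tangent (TangentBundle 𝓘(ℝ, E) M)))
      (param x₀ p)) : ContDiffAt ℝ ∞ (pullField x₀ X) p := by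
  have := FiniteDimensional.complete ℝ E
  exact contMDiffAt_vectorSpace_iff_contDiffAt.1
    (ContMDiffAt.mpullback_vectorField_preimage (n := ∞) hX (contMDiffAt_param hp)
      (isInvertible_dparam hp) (by simp))

lemma IsRep.contMDiffAt {x₀ : M} {p : E × E} (hp : p ∈ paramDom x₀)
    {X : Π w : TangentBundle 𝓘(ℝ, E) M, TT w} {ξ : E × E → E × E} (h : IsRep x₀ X ξ p) :
    ContMDiffAt 𝓘(ℝ, E).tangent 𝓘(ℝ, E).tangent.tangent ∞
      (fun w => (⟨w, X w⟩ : TangentBundle 𝓘(ℝ, E).tangent (TangentBundle 𝓘(ℝ, E) M)))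
      (param x₀ p) := by
  refine (contMDiffAt_pushField hp h.contDiffAt).congr_of_eventuallyEq ?_
  refine (eventually_param hp).2 ?_
  filter_upwards [h.2, (isOpen_paramDom x₀).mem_nhds hp] with q hq hq'
  rw [hq, pushField_param hq']

lemma IsRep.smoothNear {x₀ : M} {p : E × E} (hp : p ∈ paramDom x₀)
    {X : Π w : TangentBundle 𝓘(ℝ, E) M, TT w} {ξ : E × E → E × E} (h : IsRep x₀ X ξ p) :
    SmoothNear X (param x₀ p) := by
  refine ⟨_, (eventually_param hp (P := fun w => ContMDiffAt 𝓘(ℝ, E).tangent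
    𝓘(ℝ, E).tangent.tangent ∞ (fun w => (⟨w, X w⟩ :
      TangentBundle 𝓘(ℝ, E).tangent (TangentBundle 𝓘(ℝ, E) M))) w)).2 ?_,
    fun w hw => ContMDiffAt.contMDiffWithinAt hw⟩
  filter_upwards [h.eventually, (isOpen_paramDom x₀).mem_nhds hp] with q hq hq'
  exact hq.contMDiffAt hq'

lemma IsRep.vertSectionNear {x₀ : M} {p : E × E} (hp : p ∈ paramDom x₀)
    {X : Π w : TangentBundle 𝓘(ℝ, E) M, TT w} {ξ : E × E → E × E} (h : IsRep x₀ X ξ p)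
    (h0 : ∀ᶠ q in 𝓝 p, (ξ q).1 = 0) : VertSectionNear X (param x₀ p) := by
  refine ⟨h.smoothNear hp, (eventually_param hp).2 ?_⟩
  filter_upwards [h.2, (isOpen_paramDom x₀).mem_nhds hp, h0] with q hq hq' hq0
  rw [hq, isVertical_dparam hq', hq0]

omit [FiniteDimensional ℝ E] in
lemma isRep_pushField {x₀ : M} {p : E × E} (hp : p ∈ paramDom x₀) {ξ : E × E → E × E}
    (hξ : ∀ᶠ q in 𝓝 p, ContDiffAt ℝ ∞ ξ q) : IsRep x₀ (pushField x₀ ξ) ξ p := by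
  refine ⟨hξ, ?_⟩
  filter_upwards [(isOpen_paramDom x₀).mem_nhds hp] with q hq
  exact pushField_param hq ξ

lemma isRep_pullField {x₀ : M} {p : E × E} (hp : p ∈ paramDom x₀)
    {X : Π w : TangentBundle 𝓘(ℝ, E) M, TT w}
    (hX : ∀ᶠ w in 𝓝 (param x₀ p),
      ContMDiffAt 𝓘(ℝ, E).tangent 𝓘(ℝ, E).tangent.tangent ∞
        (fun w => (⟨w, X w⟩ : TangentBundle 𝓘(ℝ, E).tangent (TangentBundle 𝓘(ℝ, E) M))) w) :
    IsRep x₀ X (pullField x₀ X) p := by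
  rw [eventually_param hp] at hX
  constructor
  · filter_upwards [hX, (isOpen_paramDom x₀).mem_nhds hp] with q hq hq'
    exact contDiffAt_pullField hq' hq
  · filter_upwards [(isOpen_paramDom x₀).mem_nhds hp] with q hq
    exact (dparam_pullField hq X).symm

omit [FiniteDimensional ℝ E] in
lemma IsRep.jField {x₀ : M} {p : E × E} (hp : p ∈ paramDom x₀)
    {X : Π w : TangentBundle 𝓘(ℝ, E) M, TT w} {ξ : E × E → E × E} (h : IsRep x₀ X ξ p) :
    IsRep x₀ (JField X) (fun q => (0, (ξ q).1)) p := by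
  constructor
  · filter_upwards [h.1] with q hq using contDiffAt_const.prodMk hq.fst
  · filter_upwards [h.2, (isOpen_paramDom x₀).mem_nhds hp] with q hq hq'
    rw [JField, hq, J_dparam hq']

/-- Lie brackets are natural under pull-back by the local diffeomorphism `param`, and on `E × E`
they are given by the usual formula. -/
lemma IsRep.bracket {x₀ : M} {p : E × E} (hp : p ∈ paramDom x₀)
    {X Y : Π w : TangentBundle 𝓘(ℝ, E) M, TT w} {ξ η : E × E → E × E}
    (hX : IsRep x₀ X ξ p) (hY : IsRep x₀ Y η p) :
    bracket X Y (param x₀ p) =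
      dparam x₀ p (fderiv ℝ η p (ξ p) - fderiv ℝ ξ p (η p)) := by
  have := FiniteDimensional.complete ℝ E
  have h2 : minSmoothness ℝ 2 = 2 := minSmoothness_of_isRCLikeNormedField
  have : IsManifold 𝓘(ℝ, E).tangent (minSmoothness ℝ 2) (TangentBundle 𝓘(ℝ, E) M) := by
    rw [h2]; infer_instance
  have h := VectorField.mpullback_mlieBracket (n := ∞)
    ((hX.contMDiffAt hp).mdifferentiableAt (by simp))
    ((hY.contMDiffAt hp).mdifferentiableAt (by simp)) (contMDiffAt_param hp)
    (by rw [h2]; exact WithTop.coe_le_coe.2 le_top)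
  have hpull : ∀ {Z : Π w : TangentBundle 𝓘(ℝ, E) M, TT w} {ζ : E × E → E × E},
      IsRep x₀ Z ζ p → (pullField x₀ Z) =ᶠ[𝓝 p] ζ := by
    intro Z ζ hZ
    filter_upwards [hZ.2, (isOpen_paramDom x₀).mem_nhds hp] with q hq hq'
    exact pullField_eq hq' hq
  have h2 := Filter.EventuallyEq.mlieBracket_vectorField_eq (I := 𝓘(ℝ, E × E))
    (hpull hX) (hpull hY)
  rw [← dparam_pullField hp (FinslerConn.bracket X Y)]
  congr 1
  refine h.trans (h2.trans ?_)
  refine (congrFun (VectorField.mlieBracketWithin_eq_lieBracketWithin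
    (V := ξ) (W := η) (s := univ)) p).trans ?_
  rw [VectorField.lieBracketWithin_univ]
  rfl

omit [FiniteDimensional ℝ E] in
lemma mdifferentiableAt_of_comp_param {x₀ : M} {p : E × E} (hp : p ∈ paramDom x₀)
    {f : TangentBundle 𝓘(ℝ, E) M → ℝ} (hf : DifferentiableAt ℝ (f ∘ param x₀) p) :
    MDifferentiableAt 𝓘(ℝ, E).tangent 𝓘(ℝ, ℝ) f (param x₀ p) := by
  have h := HasMFDerivAt.comp (param x₀ p)
    (by rw [extChartAt_param hp]; exact hf.hasFDerivAt.hasMFDerivAt)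
    (hasMFDerivAt_extChartAt_param hp)
  refine (h.congr_of_eventuallyEq ?_).mdifferentiableAt
  refine (eventually_param hp).2 ?_
  filter_upwards [(isOpen_paramDom x₀).mem_nhds hp] with q hq
  simp only [Function.comp, extChartAt_param hq]

omit [FiniteDimensional ℝ E] in
lemma dirDeriv_dparam {x₀ : M} {p : E × E} (hp : p ∈ paramDom x₀)
    {f : TangentBundle 𝓘(ℝ, E) M → ℝ} {φ : E × E → ℝ} (hφ : DifferentiableAt ℝ φ p)
    (hf : ∀ᶠ q in 𝓝 p, f (param x₀ q) = φ q) (q : E × E) :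
    dirDeriv f (param x₀ p) (dparam x₀ p q) = fderiv ℝ φ p q := by
  have hf' : f ∘ param x₀ =ᶠ[𝓝 p] φ := hf
  have h1 := HasMFDerivAt.comp p
    (mdifferentiableAt_of_comp_param hp (hφ.congr_of_eventuallyEq hf')).hasMFDerivAt
    (hasMFDerivAt_param hp)
  have h2 := (hφ.hasFDerivAt.congr_of_eventuallyEq hf').hasMFDerivAt
  exact DFunLike.congr_fun (hasMFDerivAt_unique h1 h2) q

end

/-! ### Local calculus of Finsler energies -/

/-- Near `p`, the function `L(x, y)` is a smooth Finsler energy: it is positively homogeneous of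
degree two in `y`, with positive definite vertical Hessian. -/
structure IsEnergyNear (L : E × E → ℝ) (p : E × E) : Prop where
  smooth : ∀ᶠ q in 𝓝 p, ContDiffAt ℝ ∞ L q
  homogeneous : ∀ᶠ q in 𝓝 p, ∀ c : ℝ, 0 < c → L (q.1, c • q.2) = c ^ 2 * L q
  posDef : ∀ᶠ q in 𝓝 p, ∀ v : E, v ≠ 0 → 0 < fderiv ℝ (fderiv ℝ L) q (0, v) (0, v)

/-- The field `σ` satisfies the Euler-Lagrange equation of `L` near `p`. -/
structure IsSprayNear (L : E × E → ℝ) (σ : E × E → E × E) (p : E × E) : Prop where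
  smooth : ∀ᶠ q in 𝓝 p, ContDiffAt ℝ ∞ σ q
  fst_eq : ∀ᶠ q in 𝓝 p, (σ q).1 = q.2
  euler_lagrange : ∀ᶠ q in 𝓝 p, ∀ v : E,
    fderiv ℝ (fderiv ℝ L) q (σ q) (0, v) = fderiv ℝ L q (v, 0)

section

variable {L : E × E → ℝ} {σ : E × E → E × E} {p : E × E}

lemma IsEnergyNear.eventually (h : IsEnergyNear L p) : ∀ᶠ q in 𝓝 p, IsEnergyNear L q := by
  filter_upwards [h.smooth.eventually_nhds, h.homogeneous.eventually_nhds,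
    h.posDef.eventually_nhds] with q h1 h2 h3 using ⟨h1, h2, h3⟩

lemma IsEnergyNear.contDiffAt (h : IsEnergyNear L p) : ContDiffAt ℝ ∞ L p := h.smooth.self_of_nhds

lemma IsEnergyNear.contDiffAt_fderiv (h : IsEnergyNear L p) : ContDiffAt ℝ ∞ (fderiv ℝ L) p :=
  h.contDiffAt.fderiv_right (by simp)

lemma IsEnergyNear.contDiffAt_fderiv_fderiv (h : IsEnergyNear L p) :
    ContDiffAt ℝ ∞ (fderiv ℝ (fderiv ℝ L)) p :=
  h.contDiffAt_fderiv.fderiv_right (by simp)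

lemma hasFDerivAt_of_contDiffAt {F G : Type*} [NormedAddCommGroup F] [NormedSpace ℝ F]
    [NormedAddCommGroup G] [NormedSpace ℝ G] {f : F → G} {x : F} (h : ContDiffAt ℝ ∞ f x) :
    HasFDerivAt f (fderiv ℝ f x) x :=
  (h.differentiableAt (by simp)).hasFDerivAt

lemma minSmoothness_two_le : minSmoothness ℝ 2 ≤ ∞ := by
  rw [minSmoothness_of_isRCLikeNormedField]
  exact WithTop.coe_le_coe.2 le_top

lemma IsEnergyNear.hessian_comm (h : IsEnergyNear L p) (a b : E × E) :
    fderiv ℝ (fderiv ℝ L) p a b = fderiv ℝ (fderiv ℝ L) p b a :=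
  h.contDiffAt.isSymmSndFDerivAt minSmoothness_two_le a b

lemma IsEnergyNear.third_comm (h : IsEnergyNear L p) (r a b : E × E) :
    fderiv ℝ (fderiv ℝ (fderiv ℝ L)) p r a b = fderiv ℝ (fderiv ℝ (fderiv ℝ L)) p a r b :=
  DFunLike.congr_fun (h.contDiffAt_fderiv.isSymmSndFDerivAt minSmoothness_two_le r a) b

/-- The symmetry of the Hessian holds at all points near `p`, hence can be differentiated. -/
lemma IsEnergyNear.third_comm' (h : IsEnergyNear L p) (r a b : E × E) :
    fderiv ℝ (fderiv ℝ (fderiv ℝ L)) p r a b = fderiv ℝ (fderiv ℝ (fderiv ℝ L)) p r b a := by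
  have h3 := hasFDerivAt_of_contDiffAt h.contDiffAt_fderiv_fderiv
  have h1 := (h3.clm_apply (hasFDerivAt_const a p)).clm_apply (hasFDerivAt_const b p)
  have h2 := (h3.clm_apply (hasFDerivAt_const b p)).clm_apply (hasFDerivAt_const a p)
  have h4 := h2.congr_of_eventuallyEq (f₁ := fun q => fderiv ℝ (fderiv ℝ L) q a b)
    (by filter_upwards [h.eventually] with q hq using hq.hessian_comm a b)
  simpa using DFunLike.congr_fun (h1.unique h4) r

/-- Euler's identity: differentiate the homogeneity relation in `c` at `c = 1`. -/
lemma IsEnergyNear.fderiv_vertical_self (h : IsEnergyNear L p) :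
    fderiv ℝ L p (0, p.2) = 2 * L p := by
  have h0 : HasDerivAt (fun c : ℝ => (p.1, c • p.2)) ((0 : E), p.2) 1 := by
    simpa using (hasDerivAt_const (1 : ℝ) p.1).prodMk ((hasDerivAt_id (1 : ℝ)).smul_const p.2)
  have hL : HasFDerivAt L (fderiv ℝ L p) ((fun c : ℝ => (p.1, c • p.2)) 1) := by
    simpa using hasFDerivAt_of_contDiffAt h.contDiffAt
  have h1 : HasDerivAt (fun c : ℝ => L (p.1, c • p.2)) (fderiv ℝ L p (0, p.2)) 1 :=
    hL.comp_hasDerivAt 1 h0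
  have h2 : HasDerivAt (fun c : ℝ => c ^ 2 * L p) (2 * L p) 1 := by
    simpa using ((hasDerivAt_id (1 : ℝ)).pow 2).mul_const (L p)
  refine h1.unique (h2.congr_of_eventuallyEq ?_)
  filter_upwards [lt_mem_nhds (zero_lt_one' ℝ)] with c hc using h.homogeneous.self_of_nhds c hc

/-- The derivative of `(0, q.2)`. -/
lemma hasFDerivAt_zero_snd (p : E × E) :
    HasFDerivAt (fun q : E × E => ((0 : E), q.2))
      ((0 : E × E →L[ℝ] E).prod (ContinuousLinearMap.snd ℝ E E)) p :=
  (hasFDerivAt_const 0 p).prodMk hasFDerivAt_snd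

/-- Differentiate Euler's identity along `a`; the motion of the argument `(0, q.2)` removes the
vertical half of one copy of `fderiv ℝ L p a`. -/
lemma IsEnergyNear.hessian_vertical_self (h : IsEnergyNear L p) (a : E × E) :
    fderiv ℝ (fderiv ℝ L) p a (0, p.2) = fderiv ℝ L p a + fderiv ℝ L p (a.1, 0) := by
  have h1 := (hasFDerivAt_of_contDiffAt h.contDiffAt_fderiv).clm_apply (hasFDerivAt_zero_snd p)
  have h2 := (hasFDerivAt_of_contDiffAt h.contDiffAt).const_mul 2
  have h3 := h2.congr_of_eventuallyEq (f₁ := fun q : E × E => fderiv ℝ L q (0, q.2))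
    (by filter_upwards [h.eventually] with q hq using hq.fderiv_vertical_self)
  have h4 := DFunLike.congr_fun (h1.unique h3) a
  have h5 : fderiv ℝ L p a = fderiv ℝ L p (a.1, 0) + fderiv ℝ L p (0, a.2) := by
    rw [← map_add]; simp
  simp at h4
  linarith

/-- For vertical arguments the previous identity loses its last term; differentiate it once more. -/
lemma IsEnergyNear.third_vertical_self (h : IsEnergyNear L p) (r : E × E) (v : E) :
    fderiv ℝ (fderiv ℝ (fderiv ℝ L)) p r (0, v) (0, p.2)
      + fderiv ℝ (fderiv ℝ L) p (0, v) (0, r.2) = fderiv ℝ (fderiv ℝ L) p r (0, v) := by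
  have h1 := ((hasFDerivAt_of_contDiffAt h.contDiffAt_fderiv_fderiv).clm_apply
    (hasFDerivAt_const ((0 : E), v) p)).clm_apply (hasFDerivAt_zero_snd p)
  have h2 := (hasFDerivAt_of_contDiffAt h.contDiffAt_fderiv).clm_apply
    (hasFDerivAt_const ((0 : E), v) p)
  have h3 := h2.congr_of_eventuallyEq
    (f₁ := fun q : E × E => fderiv ℝ (fderiv ℝ L) q (0, v) (0, q.2))
    (by
      filter_upwards [h.eventually] with q hq
      rw [hq.hessian_vertical_self, Prod.mk_zero_zero, map_zero, add_zero])
  have h4 := DFunLike.congr_fun (h1.unique h3) r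
  simp at h4
  linarith

lemma IsEnergyNear.eq_of_hessian_eq (h : IsEnergyNear L p) {u v : E}
    (huv : ∀ z, fderiv ℝ (fderiv ℝ L) p (0, u) (0, z) = fderiv ℝ (fderiv ℝ L) p (0, v) (0, z)) :
    u = v := by
  by_contra hne
  have h1 := h.posDef.self_of_nhds (u - v) (sub_ne_zero.2 hne)
  have h2 : ((0 : E), u - v) = (0, u) - (0, v) := by simp
  have h3 : fderiv ℝ (fderiv ℝ L) p (0, u - v) (0, u - v) = 0 := by
    conv_lhs => enter [1]; rw [h2, map_sub]
    rw [sub_apply, huv, sub_self]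
  exact h1.ne' h3

lemma IsSprayNear.contDiffAt (h : IsSprayNear L σ p) : ContDiffAt ℝ ∞ σ p := h.smooth.self_of_nhds

lemma IsSprayNear.fderiv_fst (h : IsSprayNear L σ p) (a : E × E) : (fderiv ℝ σ p a).1 = a.2 := by
  have h1 := (hasFDerivAt_of_contDiffAt h.contDiffAt).fst
  have h2 := (hasFDerivAt_snd (𝕜 := ℝ) (p := p)).congr_of_eventuallyEq h.fst_eq
  exact DFunLike.congr_fun (h1.unique h2) a

/-- The vertical derivative of the Euler-Lagrange equation. -/
lemma IsSprayNear.third (h : IsSprayNear L σ p) (hL : IsEnergyNear L p) (u v : E) :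
    fderiv ℝ (fderiv ℝ (fderiv ℝ L)) p (σ p) (0, u) (0, v)
      + fderiv ℝ (fderiv ℝ L) p (u, 0) (0, v)
      + fderiv ℝ (fderiv ℝ L) p (0, (fderiv ℝ σ p (0, u)).2) (0, v)
      = fderiv ℝ (fderiv ℝ L) p (0, u) (v, 0) := by
  have h1 := ((hasFDerivAt_of_contDiffAt hL.contDiffAt_fderiv_fderiv).clm_apply
    (hasFDerivAt_of_contDiffAt h.contDiffAt)).clm_apply (hasFDerivAt_const ((0 : E), v) p)
  have h2 := (hasFDerivAt_of_contDiffAt hL.contDiffAt_fderiv).clm_apply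
    (hasFDerivAt_const (v, (0 : E)) p)
  have h3 := h2.congr_of_eventuallyEq (f₁ := fun q => fderiv ℝ (fderiv ℝ L) q (σ q) (0, v))
    (by filter_upwards [h.euler_lagrange] with q hq using hq v)
  have h4 := DFunLike.congr_fun (h1.unique h3) (0, u)
  -- Since the first component of `σ` is `y`, its vertical derivative contributes `u`, the source of
  -- the mixed Hessian term.
  have h5 : fderiv ℝ σ p (0, u) = (u, 0) + (0, (fderiv ℝ σ p (0, u)).2) := by
    ext
    · simp [h.fderiv_fst]
    · simp
  have h6 := congrArg (fun z => fderiv ℝ (fderiv ℝ L) p z (0, v)) h5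
  simp only [map_add, add_apply] at h6
  rw [hL.third_comm]
  simp at h4
  linarith

/-- The dynamical covariant derivative of the fundamental tensor vanishes. -/
lemma IsSprayNear.metric (h : IsSprayNear L σ p) (hL : IsEnergyNear L p) (u v : E) :
    2 * fderiv ℝ (fderiv ℝ (fderiv ℝ L)) p (σ p) (0, u) (0, v)
      + fderiv ℝ (fderiv ℝ L) p (0, (fderiv ℝ σ p (0, u)).2) (0, v)
      + fderiv ℝ (fderiv ℝ L) p (0, u) (0, (fderiv ℝ σ p (0, v)).2) = 0 := by
  have h1 := h.third hL u v
  have h2 := h.third hL v u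
  -- After exchanging `u` and `v`, the mixed Hessian terms appear with opposite signs and cancel in
  -- the sum.
  rw [hL.third_comm', hL.hessian_comm (v, 0), hL.hessian_comm (0, v),
    hL.hessian_comm (0, (fderiv ℝ σ p (0, v)).2)] at h2
  linarith

/-- The vertical part of the spray is homogeneous of degree two. -/
lemma IsSprayNear.fderiv_vertical_self (h : IsSprayNear L σ p) (hL : IsEnergyNear L p) :
    (fderiv ℝ σ p (0, p.2)).2 = (2 : ℝ) • (σ p).2 := by
  refine hL.eq_of_hessian_eq fun v => ?_
  -- Homogeneity of `σ` is not assumed: it follows from the vertical derivative of Euler-Lagrange in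
  -- the direction `y`, where `h2` removes the third derivative of `L`. Nondegeneracy then
  -- identifies the vectors.
  have h1 := h.third hL p.2 v
  have h2 := hL.third_vertical_self (σ p) v
  have h3 := h.euler_lagrange.self_of_nhds v
  have h4 := hL.hessian_vertical_self (v, 0)
  have h5 : fderiv ℝ (fderiv ℝ L) p (σ p) (0, v) =
      fderiv ℝ (fderiv ℝ L) p (p.2, 0) (0, v) + fderiv ℝ (fderiv ℝ L) p (0, (σ p).2) (0, v) := by
    rw [← add_apply, ← map_add, Prod.mk_add_mk, zero_add, add_zero,
      ← h.fst_eq.self_of_nhds]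
  have h6 : ((0 : E), (2 : ℝ) • (σ p).2) = (2 : ℝ) • (0, (σ p).2) := by simp
  rw [h6, map_smul, smul_apply, smul_eq_mul]
  rw [hL.third_comm', hL.hessian_comm (0, p.2) (v, 0)] at h1
  rw [hL.hessian_comm (0, v) (0, (σ p).2)] at h2
  linarith

/-- The equation `dL = ω(σ, ·)` is the Euler-Lagrange equation. -/
lemma isSprayNear_of_hamilton (hL : IsEnergyNear L p) (hσ : ∀ᶠ q in 𝓝 p, ContDiffAt ℝ ∞ σ q)
    (h : ∀ᶠ q in 𝓝 p, ∀ a : E × E, fderiv ℝ L q a =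
      -(fderiv ℝ (fun r => fderiv ℝ L r (0, a.1)) q (σ q)
        - fderiv ℝ (fun r => fderiv ℝ L r (0, (σ r).1)) q a
        - fderiv ℝ L q (0, -(fderiv ℝ σ q a).1))) : IsSprayNear L σ p := by
  -- For constant `a` the bracket term cancels the part of the second derivative in which `σ` is
  -- differentiated.
  have key : ∀ᶠ q in 𝓝 p, ∀ a : E × E, fderiv ℝ L q a =
      fderiv ℝ (fderiv ℝ L) q a (0, (σ q).1) - fderiv ℝ (fderiv ℝ L) q (σ q) (0, a.1) := by
    filter_upwards [h, hL.eventually, hσ] with q hq hLq hσq a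
    have h1 := ((hasFDerivAt_of_contDiffAt hLq.contDiffAt_fderiv).clm_apply
      (hasFDerivAt_const ((0 : E), a.1) q)).fderiv
    have h2 := ((hasFDerivAt_of_contDiffAt hLq.contDiffAt_fderiv).clm_apply
      ((hasFDerivAt_const (0 : E) q).prodMk (hasFDerivAt_of_contDiffAt hσq).fst)).fderiv
    have h3 : ((0 : E), -(fderiv ℝ σ q a).1) = -(0, (fderiv ℝ σ q a).1) := by simp
    rw [hq a, h1, h2, h3, map_neg]
    simp
    ring
  have hfst : ∀ᶠ q in 𝓝 p, (σ q).1 = q.2 := by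
    filter_upwards [key, hL.eventually] with q hq hLq
    refine hLq.eq_of_hessian_eq fun z => ?_
    -- Vertical test vectors give `H((0, z), (0, σ₁))` on the right, and Euler's identity gives the
    -- same with `y` in place of `σ₁`; nondegeneracy forces `σ₁ = y`.
    have h1 := hq (0, z)
    have h2 := hLq.hessian_vertical_self (0, z)
    have h3 : ((0 : E), (0 : E)) = 0 := rfl
    simp only [h3, map_zero, sub_zero, add_zero] at h1 h2
    rw [hLq.hessian_comm, hLq.hessian_comm (0, q.2), ← h1, h2]
  refine ⟨hσ, hfst, ?_⟩
  filter_upwards [key, hfst, hL.eventually] with q hq hq1 hLq v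
  -- With `σ₁ = y`, the first Hessian term at `(v, 0)` is twice `fderiv ℝ L q (v, 0)`, which leaves
  -- Euler-Lagrange.
  have h1 := hq (v, 0)
  have h2 := hLq.hessian_vertical_self (v, 0)
  rw [hq1] at h1
  simp only at h1 h2
  linarith

end

/-! ### Finsler metrics and geodesic sprays in natural charts -/

section

variable [IsManifold 𝓘(ℝ, E) ∞ M]

/-- The energy function in a natural chart. -/
def localEnergy (F : FinslerMetric E M) (x₀ : M) (p : E × E) : ℝ := F.energy (param x₀ p)

variable {F : FinslerMetric E M} {x₀ : M} {p : E × E}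

omit [NormedSpace ℝ E] [IsManifold 𝓘(ℝ, E) ∞ M] in
lemma isOpen_paramDom_slit (x₀ : M) :
    IsOpen {p : E × E | p ∈ paramDom x₀ ∧ p.2 ≠ 0} :=
  (isOpen_paramDom x₀).inter (isOpen_ne_fun continuous_snd continuous_const)


lemma contDiffAt_localEnergy (F : FinslerMetric E M) (hp : p ∈ paramDom x₀) (hp0 : p.2 ≠ 0) :
    ContDiffAt ℝ ∞ (localEnergy F x₀) p := by
  have hs : param x₀ '' {p : E × E | p ∈ paramDom x₀ ∧ p.2 ≠ 0} ⊆ slit E M := by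
    rintro _ ⟨q, hq, rfl⟩
    exact (mem_slit_param hq.1).2 hq.2
  have h : ContMDiffAt 𝓘(ℝ, E × E) 𝓘(ℝ, ℝ) ∞ (F.toFun ∘ param x₀) p := by
    refine ContMDiffAt.comp p ?_ (contMDiffAt_param hp)
    refine (F.smooth _ ((mem_slit_param hp).2 hp0)).contMDiffAt ?_
    rw [← map_param_nhds hp, Filter.mem_map]
    filter_upwards [(isOpen_paramDom_slit x₀).mem_nhds ⟨hp, hp0⟩] with q hq
    exact hs ⟨q, hq, rfl⟩
  exact contDiffAt_const.mul (h.contDiffAt.pow 2)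

lemma localEnergy_smul (F : FinslerMetric E M) (x₀ : M) (p : E × E) (c : ℝ) (hc : 0 < c) :
    localEnergy F x₀ (p.1, c • p.2) = c ^ 2 * localEnergy F x₀ p := by
  have h := F.homogeneous ((chartAt E x₀).symm p.1) (frame x₀ p.1 p.2) c hc
  rw [← map_smul] at h
  have h' : F.toFun (param x₀ (p.1, c • p.2)) = c * F.toFun (param x₀ p) := h
  rw [localEnergy, localEnergy, FinslerMetric.energy, FinslerMetric.energy, h']
  ring

lemma sq_line_eq (F : FinslerMetric E M) (x₀ : M) (p : E × E) (u v : E) (s t : ℝ) :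
    F.toFun (⟨(chartAt E x₀).symm p.1, frame x₀ p.1 p.2 + s • frame x₀ p.1 u
      + t • frame x₀ p.1 v⟩ : TangentBundle 𝓘(ℝ, E) M) ^ 2 =
      2 * localEnergy F x₀ (p.1, (p.2 + t • v) + s • u) := by
  rw [add_right_comm, ← map_smul, ← map_smul, ← map_add, ← map_add, localEnergy,
    FinslerMetric.energy, param]
  ring

lemma hasDerivAt_fiber_line (z : E) (q : E × E) :
    HasDerivAt (fun s : ℝ => (q.1, q.2 + s • z)) ((0 : E), z) 0 := by
  simpa using (hasDerivAt_const (0 : ℝ) q.1).prodMk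
    (((hasDerivAt_id (0 : ℝ)).smul_const z).const_add q.2)

lemma hasDerivAt_comp_fiber_line {G : Type*} [NormedAddCommGroup G] [NormedSpace ℝ G]
    {f : E × E → G} {q : E × E} (hf : ContDiffAt ℝ ∞ f q) (z : E) :
    HasDerivAt (fun s : ℝ => f (q.1, q.2 + s • z)) (fderiv ℝ f q (0, z)) 0 := by
  have h := hasFDerivAt_of_contDiffAt hf
  have h0 : (q.1, q.2 + (0 : ℝ) • z) = q := by simp
  have h' : HasFDerivAt f (fderiv ℝ f q) (q.1, q.2 + (0 : ℝ) • z) := by rwa [h0]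
  exact HasFDerivAt.comp_hasDerivAt 0 h' (hasDerivAt_fiber_line z q)

lemma g_frame (F : FinslerMetric E M) (hp : p ∈ paramDom x₀) (hp0 : p.2 ≠ 0) (u v : E) :
    F.g (param x₀ p) (frame x₀ p.1 u) (frame x₀ p.1 v) =
      fderiv ℝ (fderiv ℝ (localEnergy F x₀)) p (0, u) (0, v) := by
  have hopen := (isOpen_paramDom_slit x₀).mem_nhds ⟨hp, hp0⟩
  have hcont : Filter.Tendsto (fun t : ℝ => (p.1, p.2 + t • v)) (𝓝 0) (𝓝 p) := by
    have := (hasDerivAt_fiber_line v p).continuousAt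
    rwa [ContinuousAt, zero_smul, add_zero] at this
  -- The inner derivative is computed for small `t` only, where `p.2 + t • v` avoids zero and the
  -- energy is smooth.
  have h1 : (fun t : ℝ => deriv (fun s : ℝ => 2 * localEnergy F x₀
      (p.1, (p.2 + t • v) + s • u)) 0) =ᶠ[𝓝 0]
      fun t => 2 * fderiv ℝ (localEnergy F x₀) (p.1, p.2 + t • v) (0, u) := by
    filter_upwards [hcont hopen] with t ht
    exact ((hasDerivAt_comp_fiber_line (contDiffAt_localEnergy F ht.1 ht.2) u).const_mul 2).deriv
  have hL := contDiffAt_localEnergy F hp hp0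
  have h2 := ((hasDerivAt_comp_fiber_line (hL.fderiv_right (m := ∞) (by simp)) v).clm_apply
    (hasDerivAt_const (0 : ℝ) ((0 : E), u))).const_mul 2
  have h3 := (hL.isSymmSndFDerivAt minSmoothness_two_le).eq (0, u) (0, v)
  have h4 : F.g (param x₀ p) (frame x₀ p.1 u) (frame x₀ p.1 v) = (1 / 2 : ℝ) *
      deriv (fun t : ℝ => deriv (fun s : ℝ => 2 * localEnergy F x₀
      (p.1, (p.2 + t • v) + s • u)) 0) 0 := by
    simp only [← sq_line_eq]
    rfl
  rw [h4, h1.deriv_eq, h2.deriv, h3]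
  simp

lemma isEnergyNear_localEnergy (F : FinslerMetric E M) (hp : p ∈ paramDom x₀) (hp0 : p.2 ≠ 0) :
    IsEnergyNear (localEnergy F x₀) p := by
  have hopen := (isOpen_paramDom_slit x₀).mem_nhds ⟨hp, hp0⟩
  refine ⟨?_, Filter.Eventually.of_forall fun q c hc => localEnergy_smul F x₀ q c hc, ?_⟩
  · filter_upwards [hopen] with q hq using contDiffAt_localEnergy F hq.1 hq.2
  · filter_upwards [hopen] with q hq v hv
    rw [← g_frame F hq.1 hq.2]
    exact F.posDef _ ((mem_slit_param hq.1).2 hq.2) _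
      fun h => hv (((frame_injective hq.1.1).eq_iff' (map_zero _)).1 h)

lemma gVert_dparam (F : FinslerMetric E M) (hp : p ∈ paramDom x₀) (hp0 : p.2 ≠ 0) (u v : E) :
    F.gVert (param x₀ p) (dparam x₀ p (0, u)) (dparam x₀ p (0, v)) =
      fderiv ℝ (fderiv ℝ (localEnergy F x₀)) p (0, u) (0, v) := by
  rw [FinslerMetric.gVert, vliftInv_dparam hp, vliftInv_dparam hp, g_frame F hp hp0]

/-- Euler's identity reduces `g_w(w, ·)` to the fibre derivative of the energy. -/
lemma theta_dparam (F : FinslerMetric E M) (hp : p ∈ paramDom x₀) (hp0 : p.2 ≠ 0) (a : E × E) :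
    F.theta (param x₀ p) (dparam x₀ p a) = fderiv ℝ (localEnergy F x₀) p (0, a.1) := by
  have hL := isEnergyNear_localEnergy F hp hp0
  rw [FinslerMetric.theta, dpi_dparam hp]
  refine (g_frame F hp hp0 p.2 a.1).trans ?_
  rw [hL.hessian_comm, hL.hessian_vertical_self, Prod.mk_zero_zero, map_zero, add_zero]

variable [FiniteDimensional ℝ E]

lemma isRep_spray {S : Π w : TangentBundle 𝓘(ℝ, E) M, TT w} (hS : SmoothOn S (slit E M))
    (hp : p ∈ paramDom x₀) (hp0 : p.2 ≠ 0) : IsRep x₀ S (pullField x₀ S) p := by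
  refine isRep_pullField hp ((eventually_param hp).2 ?_)
  filter_upwards [(isOpen_paramDom_slit x₀).mem_nhds ⟨hp, hp0⟩] with q hq
  refine (hS _ ((mem_slit_param hq.1).2 hq.2)).contMDiffAt ?_
  refine (eventually_param hq.1).2 ?_
  filter_upwards [(isOpen_paramDom_slit x₀).mem_nhds hq] with r hr
  exact (mem_slit_param hr.1).2 hr.2

lemma isSprayNear_pullField {S : Π w : TangentBundle 𝓘(ℝ, E) M, TT w} (hS : IsGeodesicSpray F S)
    (hp : p ∈ paramDom x₀) (hp0 : p.2 ≠ 0) :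
    IsSprayNear (localEnergy F x₀) (pullField x₀ S) p := by
  refine isSprayNear_of_hamilton (isEnergyNear_localEnergy F hp hp0)
    (isRep_spray hS.1 hp hp0).1 ?_
  filter_upwards [(isOpen_paramDom_slit x₀).mem_nhds ⟨hp, hp0⟩] with q hq a
  obtain ⟨hq, hq0⟩ := hq
  have hopen := (isOpen_paramDom_slit x₀).mem_nhds ⟨hq, hq0⟩
  -- Fields constant in the chart realise every tangent vector and suffice to test the Hamiltonian
  -- equation.
  have hY : IsRep x₀ (pushField x₀ fun _ => a) (fun _ => a) q :=
    isRep_pushField hq (Filter.Eventually.of_forall fun _ => contDiffAt_const)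
  have hSq := isRep_spray hS.1 hq hq0
  have hL := isEnergyNear_localEnergy F hq hq0
  have h := hS.2 (param x₀ q) ((mem_slit_param hq).2 hq0) _ (hY.smoothNear hq)
  rw [FinslerMetric.omega, hSq.bracket hq hY, hY.self, hSq.self,
    dirDeriv_dparam hq (φ := localEnergy F x₀) (hL.contDiffAt.differentiableAt (by simp))
      (Filter.Eventually.of_forall fun _ => rfl),
    dirDeriv_dparam hq (φ := fun r => fderiv ℝ (localEnergy F x₀) r (0, a.1)),
    dirDeriv_dparam hq (φ := fun r => fderiv ℝ (localEnergy F x₀) r (0, (pullField x₀ S r).1)),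
    theta_dparam F hq hq0] at h
  · simpa using h
  · exact (hL.contDiffAt_fderiv.clm_apply
      (contDiffAt_const.prodMk hSq.contDiffAt.fst)).differentiableAt (by simp)
  · filter_upwards [hopen, hSq.2] with r hr hr'
    rw [hr', theta_dparam F hr.1 hr.2]
  · exact (hL.contDiffAt_fderiv.clm_apply contDiffAt_const).differentiableAt (by simp)
  · filter_upwards [hopen, hY.2] with r hr hr'
    rw [hr', theta_dparam F hr.1 hr.2]

end

/-! ### The canonical connection in natural charts -/

section

variable [IsManifold 𝓘(ℝ, E) ∞ M] {x₀ : M} {p : E × E}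

lemma extChartAt_eq_of_proj_eq {w w' : TangentBundle 𝓘(ℝ, E) M} (h : w.1 = w'.1) :
    extChartAt 𝓘(ℝ, E).tangent w = extChartAt 𝓘(ℝ, E).tangent w' := by
  obtain ⟨x, v⟩ := w
  obtain ⟨x', v'⟩ := w'
  obtain rfl : x = x' := h
  rfl

/-- The preferred trivialisation of `T(TM)` at a point comes from the chart of `M` at its base
point. When that base point is `x₀`, the extension is constant in the natural chart; hence `hp0`
here and in the connection formulas below. -/
lemma isRep_extend (hp : p ∈ paramDom x₀) (hp0 : (chartAt E x₀).symm p.1 = x₀) (a : E × E) :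
    IsRep x₀ (FiberBundle.extend (E × E) (dparam x₀ p a)) (fun _ => a) p := by
  refine ⟨Filter.Eventually.of_forall fun _ => contDiffAt_const, ?_⟩
  have hφ : extChartAt 𝓘(ℝ, E).tangent (param x₀ p) =
      extChartAt 𝓘(ℝ, E).tangent (⟨x₀, 0⟩ : TangentBundle 𝓘(ℝ, E) M) :=
    extChartAt_eq_of_proj_eq hp0
  have hsrc : ∀ q ∈ paramDom (E := E) x₀,
      param x₀ q ∈ (chartAt (ModelProd E E) (param x₀ p)).source := by
    intro q hq
    rw [← extChartAt_source 𝓘(ℝ, E).tangent, hφ]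
    exact param_mem_source hq
  have hderiv : ∀ q ∈ paramDom (E := E) x₀, ∀ b : E × E,
      (trivializationAt (E × E) (TangentSpace 𝓘(ℝ, E).tangent) (param x₀ p)).continuousLinearMapAt ℝ
        (param x₀ q) (dparam x₀ q b) = b := by
    intro q hq b
    rw [TangentBundle.continuousLinearMapAt_trivializationAt (hsrc q hq), hφ]
    exact mfderiv_extChartAt_dparam hq b
  have hval : (trivializationAt (E × E) (TangentSpace 𝓘(ℝ, E).tangent) (param x₀ p)
      ⟨param x₀ p, dparam x₀ p a⟩).2 = a := by
    have h := hderiv p hp a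
    rw [Trivialization.continuousLinearMapAt_apply, Trivialization.linearMapAt_apply] at h
    exact (if_pos (hsrc p hp)).symm.trans h
  filter_upwards [(isOpen_paramDom x₀).mem_nhds hp] with q hq
  obtain ⟨b, hb⟩ := exists_dparam_eq hq (FiberBundle.extend (E × E) (dparam x₀ p a) (param x₀ q))
  have h1 := hderiv q hq b
  rw [hb, FiberBundle.extend, hval] at h1
  have h2 := Trivialization.continuousLinearMapAt_symmL (R := ℝ)
    (trivializationAt (E × E) (TangentSpace 𝓘(ℝ, E).tangent) (param x₀ p)) (hsrc q hq) a
  rw [Trivialization.symmL_apply _ (hsrc q hq)] at h2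
  rw [← hb]
  exact congrArg (dparam x₀ q) (h1.symm.trans h2)

variable [FiniteDimensional ℝ E] {F : FinslerMetric E M}
  {S : Π w : TangentBundle 𝓘(ℝ, E) M, TT w} {L : E × E → ℝ} {σ : E × E → E × E}

/-- For constant extensions both brackets are minus a derivative of `σ`, and the first component of
that derivative is known from `IsSprayNear.fderiv_fst`. -/
lemma canonicalConn_dparam (hp : p ∈ paramDom x₀) (hp0 : (chartAt E x₀).symm p.1 = x₀)
    (hS : IsRep x₀ S σ p) (hσ : IsSprayNear L σ p) (a : E × E) :
    canonicalConn S (param x₀ p) (dparam x₀ p a) =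
      dparam x₀ p (a.1, (fderiv ℝ σ p (0, a.1)).2 - a.2) := by
  have hX := isRep_extend hp hp0 a
  rw [canonicalConn, canonicalConnField, hS.bracket hp hX, hS.bracket hp (hX.jField hp),
    J_dparam hp, ← map_sub, ← map_neg]
  congr 1
  ext
  · simp [hσ.fderiv_fst]
  · simp [neg_add_eq_sub, hσ.fderiv_fst]

lemma vproj_dparam (hp : p ∈ paramDom x₀) (hp0 : (chartAt E x₀).symm p.1 = x₀)
    (hS : IsRep x₀ S σ p) (hσ : IsSprayNear L σ p) (a : E × E) :
    vproj S (param x₀ p) (dparam x₀ p a) =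
      dparam x₀ p (0, a.2 - (1 / 2 : ℝ) • (fderiv ℝ σ p (0, a.1)).2) := by
  rw [vproj, canonicalConn_dparam hp hp0 hS hσ, ← map_sub, ← map_smul]
  congr 1
  ext
  · simp
  · simp only [Prod.snd_sub, Prod.smul_snd]
    module

lemma hlift_frame (hp : p ∈ paramDom x₀) (hp0 : (chartAt E x₀).symm p.1 = x₀)
    (hS : IsRep x₀ S σ p) (hσ : IsSprayNear L σ p) (u : E) :
    hlift S (param x₀ p) (frame x₀ p.1 u) =
      dparam x₀ p (u, (1 / 2 : ℝ) • (fderiv ℝ σ p (0, u)).2) := by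
  have hex : ∃ ξ : TT (param x₀ p), IsHorizontal S (param x₀ p) ξ ∧
      dpi (param x₀ p) ξ = frame x₀ p.1 u := by
    refine ⟨dparam x₀ p (u, (1 / 2 : ℝ) • (fderiv ℝ σ p (0, u)).2), ?_, dpi_dparam hp _⟩
    rw [IsHorizontal, canonicalConn_dparam hp hp0 hS hσ]
    congr 1
    ext
    · simp
    · simp only
      module
  -- `epsilon` returns an unspecified witness. Its projection fixes the first component, and the
  -- horizontality equation `∂_yσ₂ u - b = b` fixes the second.
  obtain ⟨h1, h2⟩ := Classical.epsilon_spec hex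
  change Classical.epsilon (fun ξ : TT (param x₀ p) => IsHorizontal S (param x₀ p) ξ ∧
    dpi (param x₀ p) ξ = frame x₀ p.1 u) = _
  generalize Classical.epsilon (fun ξ : TT (param x₀ p) => IsHorizontal S (param x₀ p) ξ ∧
    dpi (param x₀ p) ξ = frame x₀ p.1 u) = ξ at h1 h2 ⊢
  obtain ⟨⟨a, b⟩, rfl⟩ := exists_dparam_eq hp ξ
  rw [dpi_dparam hp] at h2
  obtain rfl : a = u := frame_injective hp.1 h2
  rw [IsHorizontal, canonicalConn_dparam hp hp0 hS hσ] at h1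
  have h3 := congrArg Prod.snd (dparam_injective hp h1)
  simp only at h3
  congr 1
  ext
  · rfl
  · simp only
    rw [sub_eq_iff_eq_add] at h3
    rw [h3]
    module

end

/-! ### Vertical connections in natural charts -/

section

variable [IsManifold 𝓘(ℝ, E) ∞ M]

/-- Locality from the Leibniz rule: the indicator `f` of the set where `Y = Z` is constant near `w`,
and `f • Y = f • Z` everywhere. No bump function is needed, because the rule asks only for
smoothness of `f` near `w`. -/
lemma VerticalConnection.nabla_congr (D : VerticalConnection E M)
    {w : TangentBundle 𝓘(ℝ, E) M} (hw : w ∈ slit E M)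
    {Y Z : Π w : TangentBundle 𝓘(ℝ, E) M, TT w} (hY : VertSectionNear Y w)
    (hZ : VertSectionNear Z w) (h : ∀ᶠ v in 𝓝 w, Y v = Z v) (ξ : TT w) :
    D.nabla Y w ξ = D.nabla Z w ξ := by
  classical
  let U : Set (TangentBundle 𝓘(ℝ, E) M) := {v | Y v = Z v}
  let f : TangentBundle 𝓘(ℝ, E) M → ℝ := U.indicator fun _ => 1
  have hfU : ∀ v ∈ U, f v = 1 := fun v hv => indicator_of_mem hv _
  have hf : ∃ O ∈ 𝓝 w, ContMDiffOn 𝓘(ℝ, E).tangent 𝓘(ℝ, ℝ) ∞ f O :=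
    ⟨U, h, contMDiffOn_const.congr hfU⟩
  have hfYZ : (fun v => f v • Y v) = fun v => f v • Z v := by
    funext v
    by_cases hv : v ∈ U
    · rw [show Y v = Z v from hv]
    · simp only [f, indicator_of_notMem hv, zero_smul]
  have h1 := D.leibniz w hw f Y hf hY ξ
  have h2 := D.leibniz w hw f Z hf hZ ξ
  rw [hfYZ, h2, hfU w h.self_of_nhds, h.self_of_nhds, one_smul, one_smul] at h1
  exact (add_left_cancel h1).symm

variable [FiniteDimensional ℝ E] {x₀ : M} {p : E × E}

lemma IsRep.nabla_congr (D : VerticalConnection E M) (hp : p ∈ paramDom x₀) (hp0 : p.2 ≠ 0)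
    {Y Z : Π w : TangentBundle 𝓘(ℝ, E) M, TT w} {ζ : E × E → E × E} (hY : IsRep x₀ Y ζ p)
    (hZ : IsRep x₀ Z ζ p) (h0 : ∀ᶠ q in 𝓝 p, (ζ q).1 = 0) (ξ : TT (param x₀ p)) :
    D.nabla Y (param x₀ p) ξ = D.nabla Z (param x₀ p) ξ := by
  refine D.nabla_congr ((mem_slit_param hp).2 hp0) (hY.vertSectionNear hp h0)
    (hZ.vertSectionNear hp h0) ((eventually_param hp).2 ?_) ξ
  filter_upwards [hY.2, hZ.2] with q h1 h2
  rw [h1, h2]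

/-- At a zero of `g` the Leibniz rule keeps only the derivative of `g`, so the connection
coefficients drop out. -/
lemma nabla_pushField_smul (D : VerticalConnection E M) (hp : p ∈ paramDom x₀) (hp0 : p.2 ≠ 0)
    {g : E × E → ℝ} (hg : ∀ᶠ q in 𝓝 p, ContDiffAt ℝ ∞ g q) (hg0 : g p = 0) (e : E) (a : E × E) :
    D.nabla (pushField x₀ fun q => (0, g q • e)) (param x₀ p) (dparam x₀ p a) =
      dparam x₀ p (0, fderiv ℝ g p a • e) := by
  let φ := extChartAt 𝓘(ℝ, E).tangent (⟨x₀, 0⟩ : TangentBundle 𝓘(ℝ, E) M)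
  have hY : IsRep x₀ (pushField x₀ fun _ => ((0 : E), e)) (fun _ => (0, e)) p :=
    isRep_pushField hp (Filter.Eventually.of_forall fun _ => contDiffAt_const)
  have hgY : ∀ᶠ q in 𝓝 p, ContDiffAt ℝ ∞ (fun q => ((0 : E), g q • e)) q := by
    filter_upwards [hg] with q hq using contDiffAt_const.prodMk (hq.smul contDiffAt_const)
  have hφ : ∀ᶠ q in 𝓝 p, (g ∘ φ) (param x₀ q) = g q := by
    filter_upwards [(isOpen_paramDom x₀).mem_nhds hp] with q hq
    rw [Function.comp, extChartAt_param hq]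
  have hsmooth : ∃ O ∈ 𝓝 (param x₀ p), ContMDiffOn 𝓘(ℝ, E).tangent 𝓘(ℝ, ℝ) ∞ (g ∘ φ) O := by
    refine ⟨{w | ContMDiffAt 𝓘(ℝ, E).tangent 𝓘(ℝ, ℝ) ∞ (g ∘ φ) w}, (eventually_param hp).2 ?_,
      fun w hw => hw.contMDiffWithinAt⟩
    filter_upwards [hg, (isOpen_paramDom x₀).mem_nhds hp] with q hq hq'
    refine ContMDiffAt.comp (param x₀ q) ?_ (contMDiffAt_extChartAt' (by
      rw [← extChartAt_source 𝓘(ℝ, E).tangent]; exact param_mem_source hq'))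
    rw [extChartAt_param hq']
    exact hq.contMDiffAt
  have h0 : ∀ᶠ q in 𝓝 p, (((0 : E), g q • e)).1 = 0 := Filter.Eventually.of_forall fun _ => rfl
  have h1 : IsRep x₀ (fun w => (g ∘ φ) w • pushField x₀ (fun _ => ((0 : E), e)) w)
      (fun q => (0, g q • e)) p := by
    refine ⟨hgY, ?_⟩
    filter_upwards [hφ, hY.2] with q hq hq'
    rw [hq, hq', ← map_smul, Prod.smul_mk, smul_zero]
  rw [(isRep_pushField hp hgY).nabla_congr D hp hp0 h1 h0,
    D.leibniz _ ((mem_slit_param hp).2 hp0) _ _ hsmooth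
      (hY.vertSectionNear hp (Filter.Eventually.of_forall fun _ => rfl)), hφ.self_of_nhds, hg0,
    dirDeriv_dparam hp (hg.self_of_nhds.differentiableAt (by simp)) hφ, hY.self, ← map_smul,
    zero_smul, add_zero, Prod.smul_mk, smul_zero]

lemma nabla_zero_field (D : VerticalConnection E M) (hp : p ∈ paramDom x₀) (hp0 : p.2 ≠ 0)
    {Z : Π w : TangentBundle 𝓘(ℝ, E) M, TT w} (hZ : IsRep x₀ Z (fun _ => 0) p) (a : E × E) :
    D.nabla Z (param x₀ p) (dparam x₀ p a) = 0 := by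
  have h := nabla_pushField_smul D hp hp0 (g := fun _ => 0)
    (Filter.Eventually.of_forall fun _ => contDiffAt_const) rfl 0 a
  simp only [smul_zero, Prod.mk_zero_zero, map_zero] at h
  rw [← h]
  exact hZ.nabla_congr D hp hp0
    (isRep_pushField hp (Filter.Eventually.of_forall fun _ => contDiffAt_const))
    (Filter.Eventually.of_forall fun _ => rfl) _

lemma IsRep.nabla_add (D : VerticalConnection E M) (hp : p ∈ paramDom x₀) (hp0 : p.2 ≠ 0)
    {X Y Z : Π w : TangentBundle 𝓘(ℝ, E) M, TT w} {ξ η : E × E → E}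
    (hX : IsRep x₀ X (fun q => (0, ξ q)) p) (hY : IsRep x₀ Y (fun q => (0, η q)) p)
    (hZ : IsRep x₀ Z (fun q => (0, ξ q + η q)) p) (v : TT (param x₀ p)) :
    D.nabla Z (param x₀ p) v = D.nabla X (param x₀ p) v + D.nabla Y (param x₀ p) v := by
  have h0 : ∀ ζ : E × E → E, ∀ᶠ q in 𝓝 p, (((0 : E), ζ q)).1 = 0 :=
    fun ζ => Filter.Eventually.of_forall fun _ => rfl
  rw [← D.add _ ((mem_slit_param hp).2 hp0) _ _ (hX.vertSectionNear hp (h0 _))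
    (hY.vertSectionNear hp (h0 _))]
  refine hZ.nabla_congr D hp hp0 ⟨hZ.1, ?_⟩ (h0 _) v
  filter_upwards [hX.2, hY.2] with q h1 h2
  rw [h1, h2, ← map_add, Prod.mk_add_mk, zero_add]

/-- The covariant derivative of a vertical section at a zero of the section. -/
lemma IsRep.nabla_of_eq_zero (D : VerticalConnection E M) (hp : p ∈ paramDom x₀) (hp0 : p.2 ≠ 0)
    {Z : Π w : TangentBundle 𝓘(ℝ, E) M, TT w} {ζ : E × E → E}
    (hζ : ∀ᶠ q in 𝓝 p, ContDiffAt ℝ ∞ ζ q)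
    (hZ : IsRep x₀ Z (fun q => (0, ζ q)) p) (hζ0 : ζ p = 0) (a : E × E) :
    D.nabla Z (param x₀ p) (dparam x₀ p a) = dparam x₀ p (0, fderiv ℝ ζ p a) := by
  classical
  -- Writing `ζ` in a basis reduces the claim to scalar multiples of constant sections, with
  -- coefficients vanishing at `p`; additivity sums them.
  let b := Module.finBasis ℝ E
  let c : Fin (Module.finrank ℝ E) → E →L[ℝ] ℝ := fun i => (b.coord i).toContinuousLinearMap
  have hb : ∀ v : E, ∑ i, c i v • b i = v := fun v => b.sum_repr v
  have hc : ∀ i, ∀ᶠ q in 𝓝 p, ContDiffAt ℝ ∞ (fun q => c i (ζ q)) q := fun i => by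
    filter_upwards [hζ] with q hq using (c i).contDiff.contDiffAt.comp q hq
  have hcs : ∀ s : Finset (Fin (Module.finrank ℝ E)), ∀ᶠ q in 𝓝 p,
      ContDiffAt ℝ ∞ (fun q => ((0 : E), ∑ i ∈ s, c i (ζ q) • b i)) q := fun s => by
    have := (Filter.eventually_all).2 hc
    filter_upwards [this] with q hq
    exact contDiffAt_const.prodMk (ContDiffAt.sum fun i _ => (hq i).smul contDiffAt_const)
  have hc1 : ∀ i, ∀ᶠ q in 𝓝 p,
      ContDiffAt ℝ ∞ (fun q => ((0 : E), c i (ζ q) • b i)) q := fun i => by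
    filter_upwards [hc i] with q hq using contDiffAt_const.prodMk (hq.smul contDiffAt_const)
  have key : ∀ s : Finset (Fin (Module.finrank ℝ E)),
      D.nabla (pushField x₀ fun q => (0, ∑ i ∈ s, c i (ζ q) • b i)) (param x₀ p) (dparam x₀ p a) =
        dparam x₀ p (0, ∑ i ∈ s, c i (fderiv ℝ ζ p a) • b i) := by
    intro s
    induction s using Finset.induction_on with
    | empty =>
      simp only [Finset.sum_empty, Prod.mk_zero_zero, map_zero]
      exact nabla_zero_field D hp hp0 (isRep_pushField hp
        (Filter.Eventually.of_forall fun _ => contDiffAt_const)) a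
    | insert i s hi ih =>
      have h1 := isRep_pushField hp (hcs (insert i s))
      simp only [Finset.sum_insert hi] at h1 ⊢
      rw [(isRep_pushField hp (hc1 i)).nabla_add D hp hp0 (isRep_pushField hp (hcs s)) h1, ih,
        nabla_pushField_smul D hp hp0 (hc i) (by simp [hζ0]), ← map_add, Prod.mk_add_mk, zero_add]
      have h2 := ((c i).hasFDerivAt.comp p (hasFDerivAt_of_contDiffAt hζ.self_of_nhds)).fderiv
      have h3 : fderiv ℝ (fun q => c i (ζ q)) p = (c i).comp (fderiv ℝ ζ p) := h2
      rw [h3]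
      rfl
  have h := key Finset.univ
  simp only [hb] at h
  rw [← h]
  exact hZ.nabla_congr D hp hp0 (isRep_pushField hp hZ.1)
    (Filter.Eventually.of_forall fun _ => rfl) _

end

/-! ### Vector fields on `M` in a chart -/

/-- The coordinate expression of a vector field on `M`. -/
def fieldRep [IsManifold 𝓘(ℝ, E) ∞ M] (x₀ : M) (V : Π x : M, TangentSpace 𝓘(ℝ, E) x) (z : E) : E :=
  (extChartAt 𝓘(ℝ, E).tangent (⟨x₀, 0⟩ : TangentBundle 𝓘(ℝ, E) M)
    ⟨(chartAt E x₀).symm z, V ((chartAt E x₀).symm z)⟩).2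

section

variable [IsManifold 𝓘(ℝ, E) ∞ M] {x₀ : M} {z : E} {V W T U : Π x : M, TangentSpace 𝓘(ℝ, E) x}

lemma frame_fieldRep (V : Π x : M, TangentSpace 𝓘(ℝ, E) x) (hz : z ∈ (chartAt E x₀).target) :
    frame x₀ z (fieldRep x₀ V z) = V ((chartAt E x₀).symm z) := by
  obtain ⟨v, hv⟩ := exists_frame_eq hz (V ((chartAt E x₀).symm z))
  have hp : (z, v) ∈ paramDom x₀ := ⟨hz, mem_univ _⟩
  have h : param x₀ (z, v) = ⟨(chartAt E x₀).symm z, V ((chartAt E x₀).symm z)⟩ := by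
    rw [← hv]; rfl
  rw [fieldRep, ← h, extChartAt_param hp, hv]

lemma param_fieldRep (V : Π x : M, TangentSpace 𝓘(ℝ, E) x) (hz : z ∈ (chartAt E x₀).target) :
    param x₀ (z, fieldRep x₀ V z) =
      ⟨(chartAt E x₀).symm z, V ((chartAt E x₀).symm z)⟩ := by
  rw [← frame_fieldRep V hz]; rfl

lemma contDiffAt_fieldRep {O : Set M} (hO : IsOpen O) (hV : SmoothFieldOn V O)
    (hz : z ∈ (chartAt E x₀).target) (hzO : (chartAt E x₀).symm z ∈ O) :
    ContDiffAt ℝ ∞ (fieldRep x₀ V) z := by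
  have h1 : ContMDiffAt 𝓘(ℝ, E) 𝓘(ℝ, E) ∞ (chartAt E x₀).symm z :=
    contMDiffOn_chart_symm.contMDiffAt ((chartAt E x₀).open_target.mem_nhds hz)
  have h2 := ContMDiffAt.comp z ((hV _ hzO).contMDiffAt (hO.mem_nhds hzO)) h1
  have hsrc : (⟨(chartAt E x₀).symm z, V ((chartAt E x₀).symm z)⟩ : TangentBundle 𝓘(ℝ, E) M) ∈
      (chartAt (ModelProd E E) (⟨x₀, 0⟩ : TangentBundle 𝓘(ℝ, E) M)).source := by
    rw [← extChartAt_source 𝓘(ℝ, E).tangent, ← param_fieldRep V hz]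
    exact param_mem_source ⟨hz, mem_univ _⟩
  have h3 := ContMDiffAt.comp z (contMDiffAt_extChartAt' (I := 𝓘(ℝ, E).tangent) (n := ∞) hsrc) h2
  exact h3.contDiffAt.snd

lemma eventually_contDiffAt_fieldRep {O : Set M} (hO : IsOpen O) (hV : SmoothFieldOn V O)
    (hz : z ∈ (chartAt E x₀).target) (hzO : (chartAt E x₀).symm z ∈ O) :
    ∀ᶠ x in 𝓝 z, ContDiffAt ℝ ∞ (fieldRep x₀ V) x := by
  filter_upwards [((chartAt E x₀).isOpen_inter_preimage_symm hO).mem_nhds ⟨hz, hzO⟩] with x hx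
  exact contDiffAt_fieldRep hO hV hx.1 hx.2

lemma isRep_vliftField {p : E × E} (hp : p ∈ paramDom x₀)
    (hV : ∀ᶠ x in 𝓝 p.1, ContDiffAt ℝ ∞ (fieldRep x₀ V) x) :
    IsRep x₀ (vliftField V) (fun q => (0, fieldRep x₀ V q.1)) p := by
  constructor
  · filter_upwards [continuousAt_fst.eventually hV] with q hq
    exact contDiffAt_const.prodMk (hq.comp q contDiffAt_fst)
  · filter_upwards [(isOpen_paramDom x₀).mem_nhds hp] with q hq
    rw [← vlift_frame hq, frame_fieldRep V hq.1]
    rfl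

lemma isRep_canonicalField {p : E × E} (hp : p ∈ paramDom x₀) :
    IsRep x₀ canonicalField (fun q => (0, q.2)) p := by
  refine ⟨Filter.Eventually.of_forall fun q => contDiffAt_const.prodMk contDiffAt_snd, ?_⟩
  filter_upwards [(isOpen_paramDom x₀).mem_nhds hp] with q hq using canonicalField_param hq

lemma gAlong_chart_symm (F : FinslerMetric E M) (hz : z ∈ (chartAt E x₀).target)
    (hW0 : fieldRep x₀ W z ≠ 0) :
    F.gAlong W V T ((chartAt E x₀).symm z) =
      fderiv ℝ (fderiv ℝ (localEnergy F x₀)) (z, fieldRep x₀ W z)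
        (0, fieldRep x₀ V z) (0, fieldRep x₀ T z) := by
  rw [FinslerMetric.gAlong, ← frame_fieldRep V hz, ← frame_fieldRep T hz, ← frame_fieldRep W hz]
  exact g_frame F (p := (z, fieldRep x₀ W z)) ⟨hz, mem_univ _⟩ hW0 _ _

lemma mvfderiv_chart_symm {f : M → ℝ} {h : E → ℝ} (hz : z ∈ (chartAt E x₀).target)
    (hh : DifferentiableAt ℝ h z) (hf : ∀ᶠ x in 𝓝 z, f ((chartAt E x₀).symm x) = h x) :
    MDifferentiableAt 𝓘(ℝ, E) 𝓘(ℝ, ℝ) f ((chartAt E x₀).symm z) ∧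
      ∀ u, mvfderiv 𝓘(ℝ, E) f ((chartAt E x₀).symm z) (frame x₀ z u) = fderiv ℝ h z u := by
  have hsrc := (chartAt E x₀).map_target hz
  have h1 : MDifferentiableAt 𝓘(ℝ, E) 𝓘(ℝ, ℝ) f ((chartAt E x₀).symm z) := by
    have h2 := HasMFDerivAt.comp ((chartAt E x₀).symm z) (g := h)
      (by rw [(chartAt E x₀).right_inv hz]; exact hh.hasFDerivAt.hasMFDerivAt)
      (mdifferentiableAt_atlas (I := 𝓘(ℝ, E)) (chart_mem_atlas E x₀) hsrc).hasMFDerivAt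
    refine (h2.congr_of_eventuallyEq ?_).mdifferentiableAt
    have h3 := (chartAt E x₀).symm.map_nhds_eq (x := z) hz
    rw [← h3]
    refine Filter.eventually_map.2 ?_
    filter_upwards [hf, (chartAt E x₀).open_target.mem_nhds hz] with x hx hx'
    rw [hx, Function.comp, (chartAt E x₀).right_inv hx']
  refine ⟨h1, fun u => ?_⟩
  have h4 := HasMFDerivAt.comp z h1.hasMFDerivAt (hasMFDerivAt_chart_symm hz)
  have h5 := (hh.hasFDerivAt.congr_of_eventuallyEq (f₁ := f ∘ (chartAt E x₀).symm) hf).hasMFDerivAt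
  exact DFunLike.congr_fun (hasMFDerivAt_unique h4 h5) u

/-- Along an integral curve of `W` that is a geodesic, the spray is tangent to the image of `W`. -/
lemma pullField_eq_of_isGeodesicOn {S : Π w : TangentBundle 𝓘(ℝ, E) M, TT w}
    (hz : z ∈ (chartAt E x₀).target) (hW : ContDiffAt ℝ ∞ (fieldRep x₀ W) z)
    {γ : ℝ → M} {I : Set ℝ} {t₀ : ℝ} (hI : IsOpen I) (ht₀ : t₀ ∈ I)
    (hγ₀ : γ t₀ = (chartAt E x₀).symm z) (hγ : IsMIntegralCurveOn γ W I)
    (hS : IsGeodesicOn S γ I) :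
    pullField x₀ S (z, fieldRep x₀ W z) =
      (fieldRep x₀ W z, fderiv ℝ (fieldRep x₀ W) z (fieldRep x₀ W z)) := by
  have hγt : ∀ t ∈ I, HasMFDerivAt 𝓘(ℝ, ℝ) 𝓘(ℝ, E) γ t
      ((1 : ℝ →L[ℝ] ℝ).smulRight (W (γ t))) := fun t ht =>
    (hγ t ht).hasMFDerivAt (hI.mem_nhds ht)
  have hsrc : γ t₀ ∈ (chartAt E x₀).source := hγ₀ ▸ (chartAt E x₀).map_target hz
  have hnear : ∀ᶠ t in 𝓝 t₀, t ∈ I ∧ γ t ∈ (chartAt E x₀).source :=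
    (hI.eventually_mem ht₀).and ((hγt t₀ ht₀).continuousAt.eventually
      ((chartAt E x₀).open_source.mem_nhds hsrc))
  let δ : ℝ → E := chartAt E x₀ ∘ γ
  have hδ₀ : δ t₀ = z := by
    simp only [δ, Function.comp, hγ₀, (chartAt E x₀).right_inv hz]
  obtain ⟨d, hd⟩ : ∃ d : E, HasDerivAt δ d t₀ := by
    have h := HasMFDerivAt.comp t₀
      (mdifferentiableAt_atlas (I := 𝓘(ℝ, E)) (chart_mem_atlas E x₀) hsrc).hasMFDerivAt
      (hγt t₀ ht₀)
    exact ⟨_, (mdifferentiableAt_iff_differentiableAt.1 h.mdifferentiableAt).hasDerivAt⟩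
  have hdM := hd.hasFDerivAt.hasMFDerivAt
  -- Both `d` and the local expression of `W` represent the velocity of `γ` at `t₀`.
  have hd_eq : d = fieldRep x₀ W z := by
    have h1 := HasMFDerivAt.comp t₀ (g := (chartAt E x₀).symm)
      (by rw [hδ₀]; exact hasMFDerivAt_chart_symm hz) hdM
    have h2 := (hγt t₀ ht₀).congr_of_eventuallyEq (f₁ := (chartAt E x₀).symm ∘ δ) (by
      filter_upwards [hnear] with t ht
      exact (chartAt E x₀).left_inv ht.2)
    have h3 : frame x₀ z ((1 : ℝ) • d) = (1 : ℝ) • W (γ t₀) :=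
      DFunLike.congr_fun (hasMFDerivAt_unique h1 h2) (1 : ℝ)
    have h4 : ∀ y : M, y = (chartAt E x₀).symm z →
        (W y : E) = W ((chartAt E x₀).symm z) := by rintro _ rfl; rfl
    rw [one_smul, one_smul] at h3
    exact frame_injective hz (h3.trans ((h4 _ hγ₀).trans (frame_fieldRep W hz).symm))
  have hp : (z, fieldRep x₀ W z) ∈ paramDom x₀ := ⟨hz, mem_univ _⟩
  have hcurve : HasDerivAt (fun t => (δ t, fieldRep x₀ W (δ t)))
      (d, fderiv ℝ (fieldRep x₀ W) z d) t₀ := by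
    refine hd.prodMk ?_
    have := hasFDerivAt_of_contDiffAt hW
    rw [← hδ₀] at this ⊢
    exact this.comp_hasDerivAt t₀ hd
  have hcurve₀ : (δ t₀, fieldRep x₀ W (δ t₀)) = (z, fieldRep x₀ W z) := by rw [hδ₀]
  have h1 := HasMFDerivAt.comp t₀ (g := param x₀) (f := fun t => (δ t, fieldRep x₀ W (δ t)))
    (by rw [hcurve₀]; exact hasMFDerivAt_param hp) hcurve.hasFDerivAt.hasMFDerivAt
  -- Near `t₀` the velocity curve of `γ` is `W ∘ γ`. It is thus differentiated twice over: by the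
  -- chain rule in `h1`, and as an integral curve of `S` in `h2`.
  have hvel : ∀ᶠ t in 𝓝 t₀, param x₀ (δ t, fieldRep x₀ W (δ t)) =
      (⟨γ t, mfderiv 𝓘(ℝ, ℝ) 𝓘(ℝ, E) γ t (1 : ℝ)⟩ : TangentBundle 𝓘(ℝ, E) M) := by
    filter_upwards [hnear] with t ht
    have h4 : ∀ y : M, y = γ t → (⟨y, W y⟩ : TangentBundle 𝓘(ℝ, E) M) = ⟨γ t, W (γ t)⟩ := by
      rintro _ rfl; rfl
    have h5 := (DFunLike.congr_fun (hγt t ht.1).mfderiv (1 : ℝ)).trans (one_smul ℝ (W (γ t)))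
    exact (param_fieldRep W ((chartAt E x₀).map_source ht.2)).trans
      ((h4 _ ((chartAt E x₀).left_inv ht.2)).trans (congrArg (TotalSpace.mk (γ t)) h5.symm))
  have h2 := ((hS.2 t₀ ht₀).hasMFDerivAt (hI.mem_nhds ht₀)).congr_of_eventuallyEq hvel
  have h3 := DFunLike.congr_fun (hasMFDerivAt_unique h1 h2) (1 : ℝ)
  have h5 : ∀ w : TangentBundle 𝓘(ℝ, E) M, w = param x₀ (z, fieldRep x₀ W z) →
      (S w : E × E) = S (param x₀ (z, fieldRep x₀ W z)) := by rintro _ rfl; rfl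
  have h6 := h5 _ (hvel.self_of_nhds.symm.trans (by rw [hδ₀]))
  refine pullField_eq hp ?_
  have h7 : dparam x₀ (z, fieldRep x₀ W z) ((1 : ℝ) • (d, fderiv ℝ (fieldRep x₀ W) z d)) =
      (1 : ℝ) • S (param x₀ (z, fieldRep x₀ W z)) := h3.trans (congrArg (fun e : E × E => (1 : ℝ) • e) h6)
  rw [one_smul, one_smul] at h7
  rw [← h7, hd_eq]

end

/-! ### The affine connections and their compatibility with the metric -/

section

variable [IsManifold 𝓘(ℝ, E) ∞ M] [FiniteDimensional ℝ E] {x₀ : M} {p : E × E}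
  {F : FinslerMetric E M} {S : Π w : TangentBundle 𝓘(ℝ, E) M, TT w} {D : VerticalConnection E M}
  {V W U T : Π x : M, TangentSpace 𝓘(ℝ, E) x}

lemma exists_nabla_vliftField_eq (D : VerticalConnection E M) (hp : p ∈ paramDom x₀)
    (hp0 : p.2 ≠ 0) (hV : ∀ᶠ x in 𝓝 p.1, ContDiffAt ℝ ∞ (fieldRep x₀ V) x)
    (ξ : TT (param x₀ p)) :
    ∃ c : E, D.nabla (vliftField V) (param x₀ p) ξ = dparam x₀ p (0, c) := by
  obtain ⟨⟨a, c⟩, hac⟩ := exists_dparam_eq hp (D.nabla (vliftField V) (param x₀ p) ξ)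
  have h := D.vertical (param x₀ p) ((mem_slit_param hp).2 hp0) (vliftField V)
    ((isRep_vliftField hp hV).vertSectionNear hp (Filter.Eventually.of_forall fun _ => rfl)) ξ
  rw [← hac, isVertical_dparam hp] at h
  obtain rfl : a = 0 := h
  exact ⟨c, hac.symm⟩

/-- The covariant derivatives of `W^𝔳` and `C` at `W` differ by the derivative of `W^𝔳 - C`. -/
lemma nabla_vliftField_self (hD : IsLift S D) (hp : p ∈ paramDom x₀) (hp0 : p.2 ≠ 0)
    (hpx : (chartAt E x₀).symm p.1 = x₀) {σ : E × E → E × E} {L : E × E → ℝ}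
    (hS : IsRep x₀ S σ p) (hσ : IsSprayNear L σ p)
    (hW : ∀ᶠ x in 𝓝 p.1, ContDiffAt ℝ ∞ (fieldRep x₀ W) x) (hWp : fieldRep x₀ W p.1 = p.2)
    (a : E × E) :
    D.nabla (vliftField W) (param x₀ p) (dparam x₀ p a) =
      dparam x₀ p (0, fderiv ℝ (fieldRep x₀ W) p.1 a.1
        - (1 / 2 : ℝ) • (fderiv ℝ σ p (0, a.1)).2) := by
  -- `ζ` represents `W^𝔳 - C`, which vanishes at `p`: the derivative of `C` is known from the lift
  -- property and that of the remainder needs no connection.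
  let ζ : E × E → E := fun q => fieldRep x₀ W q.1 - q.2
  have hζ : ∀ᶠ q in 𝓝 p, ContDiffAt ℝ ∞ ζ q := by
    filter_upwards [continuousAt_fst.eventually hW] with q hq
    exact (hq.comp q contDiffAt_fst).sub contDiffAt_snd
  have hZ : IsRep x₀ (pushField x₀ fun q => (0, ζ q)) (fun q => (0, ζ q)) p :=
    isRep_pushField hp (by filter_upwards [hζ] with q hq using contDiffAt_const.prodMk hq)
  have hWr := isRep_vliftField hp hW
  have hsum : IsRep x₀ (vliftField W) (fun q => (0, q.2 + ζ q)) p := by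
    simpa only [ζ, add_sub_cancel] using hWr
  rw [(isRep_canonicalField hp).nabla_add D hp hp0 hZ hsum,
    hD _ ((mem_slit_param hp).2 hp0), vproj_dparam hp hpx hS hσ,
    hZ.nabla_of_eq_zero D hp hp0 hζ (by simp only [ζ, hWp, sub_self]), ← map_add]
  have h1 := ((hasFDerivAt_of_contDiffAt hW.self_of_nhds).comp p hasFDerivAt_fst).sub
    (hasFDerivAt_snd (𝕜 := ℝ) (p := p))
  have h2 : fderiv ℝ ζ p = _ := h1.fderiv
  rw [h2]
  congr 1
  ext
  · simp
  · simp only [Prod.snd_add, sub_apply, ContinuousLinearMap.comp_apply,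
      ContinuousLinearMap.coe_fst', ContinuousLinearMap.coe_snd']
    abel

lemma affineAt_param (hp : p ∈ paramDom x₀) (hpx : (chartAt E x₀).symm p.1 = x₀)
    {σ : E × E → E × E} {L : E × E → ℝ} (hS : IsRep x₀ S σ p) (hσ : IsSprayNear L σ p) {u c : E}
    (h : D.nabla (vliftField V) (param x₀ p)
      (dparam x₀ p (u, (1 / 2 : ℝ) • (fderiv ℝ σ p (0, u)).2)) = dparam x₀ p (0, c)) :
    affineAt S D (param x₀ p) (frame x₀ p.1 u) V = frame x₀ p.1 c := by
  rw [← hlift_frame hp hpx hS hσ] at h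
  exact (congrArg (vliftInv (param x₀ p)) h).trans (vliftInv_dparam hp c)

omit [FiniteDimensional ℝ E] in
lemma affineConn_chart_symm {z : E} (hz : z ∈ (chartAt E x₀).target) (u : E)
    (hu : U ((chartAt E x₀).symm z) = frame x₀ z u) :
    affineConn S D W U V ((chartAt E x₀).symm z) =
      affineAt S D (param x₀ (z, fieldRep x₀ W z)) (frame x₀ z u) V := by
  rw [affineConn, ← frame_fieldRep W hz, hu]
  rfl

/-- The torsion condition (M2) at a vertical vector. -/
lemma hessian_nabla_vertical_eq_zero (hS : IsGeodesicSpray F S) (hM2 : CondM2 F S D)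
    (hp : p ∈ paramDom x₀) (hp0 : p.2 ≠ 0)
    (hV : ∀ᶠ x in 𝓝 p.1, ContDiffAt ℝ ∞ (fieldRep x₀ V) x) {z c : E}
    (hc : D.nabla (vliftField V) (param x₀ p) (dparam x₀ p (0, z)) = dparam x₀ p (0, c)) :
    fderiv ℝ (fderiv ℝ (localEnergy F x₀)) p (0, c) (0, p.2) = 0 := by
  have hSr := isRep_spray hS.1 hp hp0
  have hσ := isSprayNear_pullField hS hp hp0
  have hVr := isRep_vliftField hp hV
  -- With `X = (z, 0)` and `Y = (V, 0)` one has `𝒥X = (0, z)`, `𝒥Y = V^𝔳` and `𝒥𝒥X = 0`. Since `V`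
  -- does not depend on the fibre variable, `𝒥[𝒥X, Y] = 0` too, so `𝒞(X, Y)` is exactly `∇_{𝒥X}
  -- V^𝔳`.
  have hX : IsRep x₀ (pushField x₀ fun _ => (z, (0 : E))) (fun _ => (z, 0)) p :=
    isRep_pushField hp (Filter.Eventually.of_forall fun _ => contDiffAt_const)
  have hYs : ∀ᶠ q : E × E in 𝓝 p, ContDiffAt ℝ ∞ (fun q : E × E => (fieldRep x₀ V q.1, (0 : E))) q := by
    filter_upwards [continuousAt_fst.eventually hV] with q hq
    exact (hq.comp q contDiffAt_fst).prodMk contDiffAt_const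
  have hY := isRep_pushField hp hYs
  have hJX := hX.jField hp
  have hJY := hY.jField hp
  have h := hM2 (param x₀ p) ((mem_slit_param hp).2 hp0) _ _ (hX.smoothNear hp) (hY.smoothNear hp)
  have h0 : ∀ᶠ q : E × E in 𝓝 p, (((0 : E), fieldRep x₀ V q.1)).1 = 0 :=
    Filter.Eventually.of_forall fun _ => rfl
  have hbr : (fderiv ℝ (fun q : E × E => (fieldRep x₀ V q.1, (0 : E))) p (0, z)).1 = 0 := by
    have h1 := ((hasFDerivAt_of_contDiffAt hV.self_of_nhds).comp p hasFDerivAt_fst).prodMk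
      (hasFDerivAt_const (0 : E) p)
    have h2 : fderiv ℝ (fun q : E × E => (fieldRep x₀ V q.1, (0 : E))) p = _ := h1.fderiv
    rw [h2]
    simp
  rw [calC, torsion, hJX.self, hJY.nabla_congr D hp hp0 hVr h0, hc, hY.self,
    nabla_zero_field D hp hp0 (hJX.jField hp), hJX.bracket hp hY, J_dparam hp, hSr.self,
    J_dparam hp, hσ.fst_eq.self_of_nhds, Prod.fst_sub, hbr] at h
  simp only [fderiv_fun_const, Pi.zero_apply, zero_apply, Prod.fst_zero, sub_zero,
    Prod.mk_zero_zero, map_zero] at h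
  rwa [gVert_dparam F hp hp0] at h

/-- The torsion condition (T1) determines the covariant derivative along the spray. -/
lemma nabla_vliftField_spray (hS : IsGeodesicSpray F S) (hD : IsLift S D) (hT1 : CondT1 S D)
    (hp : p ∈ paramDom x₀) (hp0 : p.2 ≠ 0) (hpx : (chartAt E x₀).symm p.1 = x₀)
    (hV : ∀ᶠ x in 𝓝 p.1, ContDiffAt ℝ ∞ (fieldRep x₀ V) x) :
    D.nabla (vliftField V) (param x₀ p) (dparam x₀ p (pullField x₀ S p)) =
      dparam x₀ p (0, fderiv ℝ (fieldRep x₀ V) p.1 p.2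
        - (1 / 2 : ℝ) • (fderiv ℝ (pullField x₀ S) p (0, fieldRep x₀ V p.1)).2) := by
  have hSr := isRep_spray hS.1 hp hp0
  have hσ := isSprayNear_pullField hS hp hp0
  have hVr := isRep_vliftField hp hV
  have hYs : ∀ᶠ q : E × E in 𝓝 p, ContDiffAt ℝ ∞ (fun q : E × E => (fieldRep x₀ V q.1, (0 : E))) q := by
    filter_upwards [continuousAt_fst.eventually hV] with q hq
    exact (hq.comp q contDiffAt_fst).prodMk contDiffAt_const
  have hY := isRep_pushField hp hYs
  have hJY := hY.jField hp
  have h0 : ∀ ζ : E × E → E, ∀ᶠ q : E × E in 𝓝 p, (((0 : E), ζ q)).1 = 0 :=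
    fun ζ => Filter.Eventually.of_forall fun _ => rfl
  -- `𝒥S = C`, so the term `∇_Y 𝒥S` of the torsion is `𝒱Y` by the lift property.
  have hJS : IsRep x₀ (JField S) (fun q => (0, q.2)) p := by
    refine ⟨(isRep_canonicalField hp).1, ?_⟩
    filter_upwards [(hSr.jField hp).2, hσ.fst_eq] with q hq hq'
    rw [hq, hq']
  have hbr : (fderiv ℝ (fun q : E × E => (fieldRep x₀ V q.1, (0 : E))) p (pullField x₀ S p)).1 =
      fderiv ℝ (fieldRep x₀ V) p.1 p.2 := by
    have h1 := ((hasFDerivAt_of_contDiffAt hV.self_of_nhds).comp p hasFDerivAt_fst).prodMk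
      (hasFDerivAt_const (0 : E) p)
    have h2 : fderiv ℝ (fun q : E × E => (fieldRep x₀ V q.1, (0 : E))) p = _ := h1.fderiv
    rw [h2, ← hσ.fst_eq.self_of_nhds]
    simp
  have h := hT1 (param x₀ p) ((mem_slit_param hp).2 hp0) _ (hY.smoothNear hp)
  rw [torsion, hSr.self, hJY.nabla_congr D hp hp0 hVr (h0 _), hY.self,
    hJS.nabla_congr D hp hp0 (isRep_canonicalField hp) (h0 _), hD _ ((mem_slit_param hp).2 hp0),
    vproj_dparam hp hpx hSr hσ, hSr.bracket hp hY, J_dparam hp, sub_sub, ← map_add,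
    sub_eq_zero] at h
  rw [h]
  congr 1
  ext
  · simp
  · simp only [Prod.snd_add, Prod.fst_sub, hbr, hσ.fderiv_fst]
    abel

/-- By homogeneity of degree two, half of `∂_yσ₂ y` is `σ₂`; the spray is therefore horizontal. -/
lemma hlift_self_eq_spray (hS : IsGeodesicSpray F S) (hp : p ∈ paramDom x₀) (hp0 : p.2 ≠ 0) :
    (p.2, (1 / 2 : ℝ) • (fderiv ℝ (pullField x₀ S) p (0, p.2)).2) = pullField x₀ S p := by
  have hσ := isSprayNear_pullField hS hp hp0
  rw [hσ.fderiv_vertical_self (isEnergyNear_localEnergy F hp hp0), smul_smul]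
  ext
  · exact hσ.fst_eq.self_of_nhds.symm
  · norm_num

omit [FiniteDimensional ℝ E] in
/-- The derivative of the fundamental tensor along a field. -/
lemma hasFDerivAt_hessian_along {L : E × E → ℝ} {z : E} {v w t : E → E}
    (hL : IsEnergyNear L (z, w z)) (hv : ContDiffAt ℝ ∞ v z) (hw : ContDiffAt ℝ ∞ w z)
    (ht : ContDiffAt ℝ ∞ t z) :
    ∃ A : E →L[ℝ] ℝ, HasFDerivAt
      (fun x => fderiv ℝ (fderiv ℝ L) (x, w x) (0, v x) (0, t x)) A z ∧
      ∀ u, A u = fderiv ℝ (fderiv ℝ (fderiv ℝ L)) (z, w z) (u, fderiv ℝ w z u) (0, v z) (0, t z)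
        + fderiv ℝ (fderiv ℝ L) (z, w z) (0, fderiv ℝ v z u) (0, t z)
        + fderiv ℝ (fderiv ℝ L) (z, w z) (0, v z) (0, fderiv ℝ t z u) := by
  have h1 : HasFDerivAt (fun x => (x, w x)) ((ContinuousLinearMap.id ℝ E).prod (fderiv ℝ w z)) z :=
    (hasFDerivAt_id z).prodMk (hasFDerivAt_of_contDiffAt hw)
  have h2 : HasFDerivAt (fun x => fderiv ℝ (fderiv ℝ L) (x, w x)) _ z :=
    HasFDerivAt.comp z (f := fun x => (x, w x))
      (hasFDerivAt_of_contDiffAt hL.contDiffAt_fderiv_fderiv) h1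
  have h3 := (h2.clm_apply ((hasFDerivAt_const (0 : E) z).prodMk
    (hasFDerivAt_of_contDiffAt hv))).clm_apply ((hasFDerivAt_const (0 : E) z).prodMk
    (hasFDerivAt_of_contDiffAt ht))
  refine ⟨_, h3, fun u => ?_⟩
  simp
  ring

end

/-! ### Differentiating the fundamental tensor along vector fields -/

section

variable [IsManifold 𝓘(ℝ, E) ∞ M] [FiniteDimensional ℝ E] {x₀ : M} {z : E}
  {F : FinslerMetric E M} {S : Π w : TangentBundle 𝓘(ℝ, E) M, TT w} {D : VerticalConnection E M}
  {V W U T : Π x : M, TangentSpace 𝓘(ℝ, E) x}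

omit [FiniteDimensional ℝ E] in
lemma mvfderiv_gAlong (hz : z ∈ (chartAt E x₀).target)
    (hV : ContDiffAt ℝ ∞ (fieldRep x₀ V) z) (hT : ContDiffAt ℝ ∞ (fieldRep x₀ T) z)
    (hW : ContDiffAt ℝ ∞ (fieldRep x₀ W) z) (hW0 : fieldRep x₀ W z ≠ 0) :
    MDifferentiableAt 𝓘(ℝ, E) 𝓘(ℝ, ℝ) (F.gAlong W V T) ((chartAt E x₀).symm z) ∧
      ∀ u, mvfderiv 𝓘(ℝ, E) (F.gAlong W V T) ((chartAt E x₀).symm z) (frame x₀ z u) =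
        fderiv ℝ (fderiv ℝ (fderiv ℝ (localEnergy F x₀))) (z, fieldRep x₀ W z)
            (u, fderiv ℝ (fieldRep x₀ W) z u) (0, fieldRep x₀ V z) (0, fieldRep x₀ T z)
          + fderiv ℝ (fderiv ℝ (localEnergy F x₀)) (z, fieldRep x₀ W z)
            (0, fderiv ℝ (fieldRep x₀ V) z u) (0, fieldRep x₀ T z)
          + fderiv ℝ (fderiv ℝ (localEnergy F x₀)) (z, fieldRep x₀ W z)
            (0, fieldRep x₀ V z) (0, fderiv ℝ (fieldRep x₀ T) z u) := by
  obtain ⟨A, hA, hAu⟩ := hasFDerivAt_hessian_along (isEnergyNear_localEnergy F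
    (p := (z, fieldRep x₀ W z)) ⟨hz, mem_univ _⟩ hW0) hV hW hT
  have h := mvfderiv_chart_symm (f := F.gAlong W V T) hz hA.differentiableAt (by
    filter_upwards [(chartAt E x₀).open_target.mem_nhds hz,
      hW.continuousAt.eventually_ne hW0] with x hx hx0
    exact gAlong_chart_symm F hx hx0)
  refine ⟨h.1, fun u => ?_⟩
  rw [h.2 u, hA.fderiv, hAu]

omit [FiniteDimensional ℝ E] in
lemma gAlong_of_eq_frame (hz : z ∈ (chartAt E x₀).target) (hW0 : fieldRep x₀ W z ≠ 0) {v t : E}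
    (hv : V ((chartAt E x₀).symm z) = frame x₀ z v)
    (ht : T ((chartAt E x₀).symm z) = frame x₀ z t) :
    F.gAlong W V T ((chartAt E x₀).symm z) =
      fderiv ℝ (fderiv ℝ (localEnergy F x₀)) (z, fieldRep x₀ W z) (0, v) (0, t) := by
  rw [gAlong_chart_symm F hz hW0]
  rw [← frame_fieldRep V hz] at hv
  rw [← frame_fieldRep T hz] at ht
  rw [frame_injective hz hv, frame_injective hz ht]

theorem mvfderiv_gAlong_self (hS : IsGeodesicSpray F S) (hD : IsLift S D) (hM1 : CondM1 F D)
    (hM2 : CondM2 F S D) (hz : z ∈ (chartAt E x₀).target) (hzx : (chartAt E x₀).symm z = x₀)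
    (hW : ∀ᶠ x in 𝓝 z, ContDiffAt ℝ ∞ (fieldRep x₀ W) x)
    (hV : ∀ᶠ x in 𝓝 z, ContDiffAt ℝ ∞ (fieldRep x₀ V) x) (hW0 : fieldRep x₀ W z ≠ 0) :
    MDifferentiableAt 𝓘(ℝ, E) 𝓘(ℝ, ℝ) (F.gAlong W W V) ((chartAt E x₀).symm z) ∧
      mvfderiv 𝓘(ℝ, E) (F.gAlong W W V) ((chartAt E x₀).symm z) (U ((chartAt E x₀).symm z)) =
        F.gAlong W (affineConn S D W U W) V ((chartAt E x₀).symm z)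
          + F.gAlong W W (affineConn S D W U V) ((chartAt E x₀).symm z) := by
  obtain ⟨hdiff, hderiv⟩ := mvfderiv_gAlong (F := F) hz hW.self_of_nhds hV.self_of_nhds
    hW.self_of_nhds hW0
  refine ⟨hdiff, ?_⟩
  set w := fieldRep x₀ W z with hw
  set v := fieldRep x₀ V z with hv
  have hp : (z, w) ∈ paramDom x₀ := ⟨hz, mem_univ _⟩
  have hSr := isRep_spray hS.1 hp hW0
  have hσ := isSprayNear_pullField hS hp hW0
  have hL := isEnergyNear_localEnergy F hp hW0
  obtain ⟨u, hu⟩ := exists_frame_eq hz (U ((chartAt E x₀).symm z))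
  obtain ⟨h, hh⟩ : ∃ h, (1 / 2 : ℝ) • (fderiv ℝ (pullField x₀ S) (z, w) (0, u)).2 = h := ⟨_, rfl⟩
  obtain ⟨d, hd⟩ : ∃ d, fderiv ℝ (fieldRep x₀ W) z u = d := ⟨_, rfl⟩
  obtain ⟨c₁, hc₁⟩ := exists_nabla_vliftField_eq D hp hW0 hV (dparam x₀ (z, w) (u, h))
  -- The vector `(u, d)` is `dW(U)`; it splits into the horizontal lift `(u, h)` of `U` and the
  -- vertical remainder `(0, d - h)`.
  obtain ⟨c₂, hc₂⟩ := exists_nabla_vliftField_eq D hp hW0 hV (dparam x₀ (z, w) (0, d - h))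
  have hVξ : D.nabla (vliftField V) (param x₀ (z, w)) (dparam x₀ (z, w) (u, d)) =
      dparam x₀ (z, w) (0, c₁ + c₂) := by
    have h1 : ((u, d) : E × E) = (u, h) + (0, d - h) := by simp
    have h2 : ((0 : E), c₁ + c₂) = (0, c₁) + (0, c₂) := by simp
    rw [h1, map_add, map_add, hc₁, hc₂, ← map_add, h2]
  have hG2 : fderiv ℝ (fderiv ℝ (localEnergy F x₀)) (z, w) (0, c₂) (0, w) = 0 :=
    hessian_nabla_vertical_eq_zero hS hM2 hp hW0 hV hc₂
  have haW : affineConn S D W U W ((chartAt E x₀).symm z) = frame x₀ z (d - h) := by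
    rw [affineConn_chart_symm hz u hu.symm]
    rw [← hd, ← hh]
    exact affineAt_param hp hzx hSr hσ (nabla_vliftField_self hD hp hW0 hzx hSr hσ hW rfl _)
  have haV : affineConn S D W U V ((chartAt E x₀).symm z) = frame x₀ z c₁ := by
    rw [affineConn_chart_symm hz u hu.symm]
    rw [← hh] at hc₁
    exact affineAt_param hp hzx hSr hσ hc₁
  have hVr := isRep_vliftField hp hV
  -- (M1) is applied along `dW(U)` rather than along the horizontal lift, so that the derivative of
  -- the metric is the one seen by `g_W`.
  have hM := hM1 (param x₀ (z, w)) ((mem_slit_param hp).2 hW0) (dparam x₀ (z, w) (u, d)) _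
    (hVr.vertSectionNear hp (Filter.Eventually.of_forall fun _ => rfl))
  have hV1 : HasFDerivAt (fun q : E × E => fieldRep x₀ V q.1)
      ((fderiv ℝ (fieldRep x₀ V) z).comp (ContinuousLinearMap.fst ℝ E E)) (z, w) :=
    HasFDerivAt.comp (z, w) (g := fieldRep x₀ V) (f := Prod.fst)
      (hasFDerivAt_of_contDiffAt hV.self_of_nhds) hasFDerivAt_fst
  have hφ := ((hasFDerivAt_of_contDiffAt hL.contDiffAt_fderiv_fderiv).clm_apply
    ((hasFDerivAt_const (0 : E) (z, w)).prodMk hV1)).clm_apply (hasFDerivAt_zero_snd (z, w))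
  rw [dirDeriv_dparam hp hφ.differentiableAt, hφ.fderiv, hVξ,
    hD _ ((mem_slit_param hp).2 hW0), vproj_dparam hp hzx hSr hσ, canonicalField_param hp,
    hVr.self, gVert_dparam F hp hW0, gVert_dparam F hp hW0] at hM
  · rw [← hu, hderiv, gAlong_of_eq_frame hz hW0 haW (frame_fieldRep V hz).symm,
      gAlong_of_eq_frame hz hW0 (frame_fieldRep W hz).symm haV]
    have h3 : ((0 : E), c₁ + c₂) = (0, c₁) + (0, c₂) := by simp
    rw [h3, map_add, add_apply, add_apply] at hM
    simp only [ContinuousLinearMap.comp_apply, ContinuousLinearMap.flip_apply, add_apply,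
      ContinuousLinearMap.prod_apply, zero_apply, ContinuousLinearMap.coe_fst',
      ContinuousLinearMap.coe_snd', ← hv, hh, hG2] at hM
    simp only [← hv, ← hw, hd]
    rw [hL.third_comm', hL.hessian_comm (0, d) (0, v), hL.hessian_comm (0, w),
      hL.hessian_comm (0, w) (0, c₁), hL.hessian_comm (0, d - h) (0, v)]
    linarith
  · filter_upwards [(isOpen_paramDom_slit x₀).mem_nhds ⟨hp, hW0⟩, hVr.2] with q hq hq'
    rw [hq', canonicalField_param hq.1, gVert_dparam F hq.1 hq.2]

theorem mvfderiv_gAlong_geodesic (hS : IsGeodesicSpray F S) (hD : IsLift S D) (hT1 : CondT1 S D)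
    (hz : z ∈ (chartAt E x₀).target) (hzx : (chartAt E x₀).symm z = x₀)
    (hW : ∀ᶠ x in 𝓝 z, ContDiffAt ℝ ∞ (fieldRep x₀ W) x)
    (hV : ∀ᶠ x in 𝓝 z, ContDiffAt ℝ ∞ (fieldRep x₀ V) x)
    (hT : ∀ᶠ x in 𝓝 z, ContDiffAt ℝ ∞ (fieldRep x₀ T) x) (hW0 : fieldRep x₀ W z ≠ 0)
    (hgeo : pullField x₀ S (z, fieldRep x₀ W z) =
      (fieldRep x₀ W z, fderiv ℝ (fieldRep x₀ W) z (fieldRep x₀ W z))) :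
    MDifferentiableAt 𝓘(ℝ, E) 𝓘(ℝ, ℝ) (F.gAlong W T V) ((chartAt E x₀).symm z) ∧
      mvfderiv 𝓘(ℝ, E) (F.gAlong W T V) ((chartAt E x₀).symm z) (W ((chartAt E x₀).symm z)) =
        F.gAlong W (affineConn S D W W T) V ((chartAt E x₀).symm z)
          + F.gAlong W T (affineConn S D W W V) ((chartAt E x₀).symm z) := by
  obtain ⟨hdiff, hderiv⟩ := mvfderiv_gAlong (F := F) hz hT.self_of_nhds hV.self_of_nhds
    hW.self_of_nhds hW0
  refine ⟨hdiff, ?_⟩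
  set w := fieldRep x₀ W z with hw
  have hp : (z, w) ∈ paramDom x₀ := ⟨hz, mem_univ _⟩
  have hSr := isRep_spray hS.1 hp hW0
  have hσ := isSprayNear_pullField hS hp hW0
  have hL := isEnergyNear_localEnergy F hp hW0
  have hWw : W ((chartAt E x₀).symm z) = frame x₀ z w := (frame_fieldRep W hz).symm
  have ha : ∀ {Y : Π x : M, TangentSpace 𝓘(ℝ, E) x},
      (∀ᶠ x in 𝓝 z, ContDiffAt ℝ ∞ (fieldRep x₀ Y) x) →
      affineConn S D W W Y ((chartAt E x₀).symm z) =
        frame x₀ z (fderiv ℝ (fieldRep x₀ Y) z w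
          - (1 / 2 : ℝ) • (fderiv ℝ (pullField x₀ S) (z, w) (0, fieldRep x₀ Y z)).2) := by
    intro Y hY
    have h1 := nabla_vliftField_spray hS hD hT1 hp hW0 hzx hY
    -- The horizontal lift of `W` at `W` is the spray, so the derivative found from (T1) is the
    -- affine one.
    rw [← hlift_self_eq_spray hS hp hW0] at h1
    rw [affineConn_chart_symm hz w hWw]
    exact affineAt_param hp hzx hSr hσ h1
  have hm := hσ.metric hL (fieldRep x₀ T z) (fieldRep x₀ V z)
  -- The geodesic hypothesis identifies `σ` at `W(x)` with `(w, ∂_w W)`, the direction in which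
  -- `hderiv` differentiates the Hessian.
  rw [hgeo] at hm
  have hsplit : ∀ a b : E, ((0 : E), a - (1 / 2 : ℝ) • b) = (0, a) - (1 / 2 : ℝ) • (0, b) := by
    intro a b; simp
  rw [hWw, hderiv, gAlong_of_eq_frame hz hW0 (ha hT) (frame_fieldRep V hz).symm,
    gAlong_of_eq_frame hz hW0 (frame_fieldRep T hz).symm (ha hV), hsplit, hsplit]
  simp only [map_sub, map_smul, sub_apply, smul_apply, smul_eq_mul]
  linarith

end

end

end FinslerConn

/-! ### From charts to points of `M` -/

theorem mainTheorem10 {E : Type*} [NormedAddCommGroup E] [NormedSpace ℝ E] [FiniteDimensional ℝ E]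
    {M : Type*} [TopologicalSpace M] [ChartedSpace E M] [IsManifold 𝓘(ℝ, E) ∞ M]
    (F : FinslerConn.FinslerMetric E M)
    (S : Π w : TangentBundle 𝓘(ℝ, E) M, FinslerConn.TT w)
    (hS : FinslerConn.IsGeodesicSpray F S)
    (D : FinslerConn.VerticalConnection E M) (hD : FinslerConn.IsLift S D)
    (O : Set M) (hO : IsOpen O)
    (W U V T : Π x : M, TangentSpace 𝓘(ℝ, E) x)
    (hW : FinslerConn.SmoothFieldOn W O) (hU : FinslerConn.SmoothFieldOn U O)
    (hV : FinslerConn.SmoothFieldOn V O) (hT : FinslerConn.SmoothFieldOn T O)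
    (hW0 : ∀ x ∈ O, W x ≠ 0) :
    (FinslerConn.CondM1 F D → FinslerConn.CondM2 F S D →
      ∀ x ∈ O,
        MDifferentiableAt 𝓘(ℝ, E) 𝓘(ℝ, ℝ) (F.gAlong W W V) x ∧
        mvfderiv 𝓘(ℝ, E) (F.gAlong W W V) x (U x) =
          F.gAlong W (FinslerConn.affineConn S D W U W) V x
            + F.gAlong W W (FinslerConn.affineConn S D W U V) x) ∧
    (FinslerConn.CondT1 S D →
      ∀ x₀ ∈ O, ∀ (γ : ℝ → M) (I : Set ℝ) (t₀ : ℝ), IsOpen I → I.OrdConnected → t₀ ∈ I →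
        γ t₀ = x₀ → MapsTo γ I O → IsMIntegralCurveOn γ W I → FinslerConn.IsGeodesicOn S γ I →
        MDifferentiableAt 𝓘(ℝ, E) 𝓘(ℝ, ℝ) (F.gAlong W T V) x₀ ∧
        mvfderiv 𝓘(ℝ, E) (F.gAlong W T V) x₀ (W x₀) =
          F.gAlong W (FinslerConn.affineConn S D W W T) V x₀
            + F.gAlong W T (FinslerConn.affineConn S D W W V) x₀) := by
  -- Each point is treated in its own preferred chart, as the local formulas for the canonical
  -- connection require.
  have hz : ∀ x : M, chartAt E x x ∈ (chartAt E x).target := mem_chart_target E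
  have hzx : ∀ x : M, (chartAt E x).symm (chartAt E x x) = x :=
    fun x => (chartAt E x).left_inv (mem_chart_source E x)
  have hrep : ∀ {Y : Π x : M, TangentSpace 𝓘(ℝ, E) x}, FinslerConn.SmoothFieldOn Y O →
      ∀ x ∈ O, ∀ᶠ z in 𝓝 (chartAt E x x), ContDiffAt ℝ ∞ (FinslerConn.fieldRep x Y) z :=
    fun hY x hx => FinslerConn.eventually_contDiffAt_fieldRep hO hY (hz x) (by rwa [hzx])
  have hW0' : ∀ x ∈ O, FinslerConn.fieldRep x W (chartAt E x x) ≠ 0 := by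
    intro x hx h0
    have h1 := FinslerConn.frame_fieldRep W (hz x)
    rw [h0, map_zero] at h1
    exact hW0 ((chartAt E x).symm (chartAt E x x)) (by rwa [hzx]) h1.symm
  constructor
  · intro hM1 hM2 x hx
    have h := FinslerConn.mvfderiv_gAlong_self (U := U) hS hD hM1 hM2 (hz x) (hzx x)
      (hrep hW x hx) (hrep hV x hx) (hW0' x hx)
    rwa [hzx] at h
  · intro hT1 x hx γ I t₀ hI _ ht₀ hγ₀ _ hγ hgeo
    have h := FinslerConn.mvfderiv_gAlong_geodesic hS hD hT1 (hz x) (hzx x)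
      (hrep hW x hx) (hrep hV x hx) (hrep hT x hx) (hW0' x hx)
      (FinslerConn.pullField_eq_of_isGeodesicOn (hz x) (hrep hW x hx).self_of_nhds hI ht₀
        (hγ₀.trans (hzx x).symm) hγ hgeo)
    rwa [hzx] at h
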